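/- For a finite simple graph $G$ with graph distance $d_G$, let $m_x$ be the uniform distribution on the neighbours of $x$. For an edge $(x,y)$ of $G$ let $\kappa_G(x,y)=1-W_1(m_x,m_y)$, where $W_1(m_x,m_y)$ is the infimum of $\sum_{z,w}\nu(z,w)\,d_G(z,w)$ over all couplings $\nu$ of $m_x$ and $m_y$ (Ollivier's coarse Ricci curvature for the simple random walk). For every integer $n\ge 2$ let $p_n\in(0,1]$, let $V_n$ be a set of $n$ vertices, and let $a,b\in V_n$ be distinct (they may depend on $n$). Let $G_n$ be the Erdős–Rényi random graph $\mathbb G(n,p_n)$ on $V_n$, in which each pair of vertices is an edge independently with probability $p_n$, conditioned on the edge $(a,b)$ being present, and let $\kappa_n(a,b)=\kappa_{G_n}(a,b)$. All limits are as $n\to\infty$. (a) If $np_n\to 0$, then with probability $1-o(1)$ the edge $(a,b)$ is isolated (neither $a$ nor $b$ has any other neighbour) and $\kappa_n(a,b)=0$; in particular $\kappa_n(a,b)\to 0$ in probability. (b) If $np_n\to\lambda$ with $0<\lambda<\infty$, then $\kappa_n(a,b)$ converges in distribution to $$-2\Bigl(1-\frac1{1+X_1}-\frac1{1+X_2}\Bigr)_+,$$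 where $X_1,X_2$ are independent $\mathrm{Poisson}(\lambda)$ random variables and $t_+=\max(t,0)$. (c) If $np_n\to\infty$ and $n^2p_n^3\to 0$, then $\kappa_n(a,b)\to -2$ in probability. (d) If $n^2p_n^3\to\infty$ and $np_n^2\to 0$, then $\kappa_n(a,b)\to -1$ in probability. (e) If $np_n^2\to\infty$ and $p_n\to 0$, then $\kappa_n(a,b)\to 0$ in probability. (f) If $p_n\to p$ with $0<p<1$, then $\kappa_n(a,b)\to p$ in probability. -/

import Mathlib

open MeasureTheory ProbabilityTheory Filter Topology unitInterval
open scoped NNReal ENNReal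

noncomputable section

namespace GraphCurvature

variable {V : Type*}

open Classical in
/-- The one-step distribution `m_x` of the simple random walk on `G` started at `x`:
mass `1 / d_x` on each neighbour of `x`, and `0` elsewhere. -/
def walkMeasure (G : SimpleGraph V) (x y : V) : ℝ :=
  if G.Adj x y then 1 / ((G.neighborSet x).ncard : ℝ) else 0

/-- `ν` is a nonnegative mass function on `V × V` with marginals `m₁` and `m₂`. -/
structure IsCoupling [Fintype V] (m₁ m₂ : V → ℝ) (ν : V → V → ℝ) : Prop where
  nonneg : ∀ x y, 0 ≤ ν x y
  fst_marginal : ∀ x, ∑ y, ν x y = m₁ x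
  snd_marginal : ∀ y, ∑ x, ν x y = m₂ y

/-- The transportation (Wasserstein) distance between two mass functions on the vertices of `G`
for the shortest path distance of `G`: the infimum of the transport costs over all couplings.
(`G.dist` is the shortest path distance whenever its arguments lie in one connected component of
`G`; for the distributions `m_x`, `m_y` at the ends of an edge, couplings charge only such pairs.) -/
def transportDist [Fintype V] (G : SimpleGraph V) (m₁ m₂ : V → ℝ) : ℝ :=
  sInf {c : ℝ | ∃ ν : V → V → ℝ, IsCoupling m₁ m₂ ν ∧ c = ∑ x, ∑ y, ν x y * (G.dist x y : ℝ)}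

/-- Ollivier's coarse Ricci curvature `κ(x, y) = 1 - W₁(m_x, m_y) / d(x, y)` for the simple random
walk on `G`; for an edge `(x, y)` the denominator is `1`. -/
def ricci [Fintype V] (G : SimpleGraph V) (x y : V) : ℝ :=
  1 - transportDist G (walkMeasure G x) (walkMeasure G y) / (G.dist x y : ℝ)

/-- The edge `(a, b)` of `G` is isolated: each endpoint has the other one as its only neighbour. -/
def IsIsolatedEdge (G : SimpleGraph V) (a b : V) : Prop :=
  G.neighborSet a = {b} ∧ G.neighborSet b = {a}

/-- The presence of a given edge has positive probability in the Erdős–Rényi graph. -/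
theorem binomialRandom_adj_ne_zero [Fintype V] {p : I} (hp : 0 < p) {a b : V} (hab : a ≠ b) :
    SimpleGraph.binomialRandom V p {G | G.Adj a b} ≠ 0 := by
  classical
  intro h
  have h1 : SimpleGraph.binomialRandom V p {(⊤ : SimpleGraph V)} = 0 :=
    measure_mono_null (by simpa using hab) h
  rw [SimpleGraph.binomialRandom_singleton] at h1
  have h2 : (Nat.card V).choose 2 - (⊤ : SimpleGraph V).edgeSet.ncard = 0 := by
    have := SimpleGraph.card_edgeFinset_top_eq_card_choose_two (V := V)
    rw [Nat.card_eq_fintype_card, ← this, ← SimpleGraph.coe_edgeFinset, Set.ncard_coe_finset]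
    simp
  rw [h2] at h1
  have h3 : (unitInterval.toNNReal p) ≠ 0 := by
    intro h4
    have : (p : ℝ) = 0 := by simpa using congrArg NNReal.toReal h4
    exact hp.ne' (Subtype.ext this)
  simp [h3] at h1

/-- The law of the Erdős–Rényi graph on the vertex set `V` with edge probability `p > 0` (each pair
of distinct vertices is an edge with probability `p`, independently), conditioned on the edge
`(a, b)` being present. -/
def erdosRenyiGivenEdge (V : Type*) [Fintype V] (p : I) (hp : 0 < p) (a b : V) (hab : a ≠ b) :
    ProbabilityMeasure (SimpleGraph V) :=
  ⟨(SimpleGraph.binomialRandom V p)[|{G | G.Adj a b}],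
    cond_isProbabilityMeasure (binomialRandom_adj_ne_zero hp hab)⟩

/-- Convergence in probability to a constant, for random variables that may live on different
probability spaces. -/
def TendstoInProbability {ι : Type*} {Ω : ι → Type*} [∀ i, MeasurableSpace (Ω i)]
    (X : (i : ι) → Ω i → ℝ) (l : Filter ι) (c : ℝ) (μ : (i : ι) → ProbabilityMeasure (Ω i)) :
    Prop :=
  ∀ ε : ℝ, 0 < ε → Tendsto (fun i ↦ (μ i : Measure (Ω i)) {ω | ε ≤ |X i ω - c|}) l (𝓝 0)

end GraphCurvature

end

/-! Any neighbour of `a` reaches any neighbour of `b` through the edge `(a, b)` in at most three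
steps, and `W₁` is governed by how far a typical unit of mass really has to travel. Given that `z`
is a neighbour of `a`, the expected number of 4-cycles through `(a, b)` and `z` is of order `n p²`,
that of 5-cycles of order `n² p³`. Hence, when degrees tend to infinity, the typical distance is 3
if `n² p³ → 0`, 2 if `n² p³ → ∞` but `n p² → 0`, and 1 if `n p² → ∞`; in the last case a fraction
`p` of the mass sits at common neighbours and need not move, so `W₁` is about `1 - p`.

Lower bounds on `W₁` come from weak duality (`le_transportDist`) with a potential that is constant
except for a penalty at vertices on short cycles: `one_sub_triCount_le`, `two_sub_quadCount_le`,
`three_sub_pentCount_le`. They leave only first moments of cycle counts to be bounded.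

Upper bounds come from explicit plans. `transportDist_walkMeasure_le` uses only the path through
`(a, b)`. The plans `pathPlan` and `edgePlan` spread mass along all available paths of length two or
one; their marginals are only approximately right, which `transportDist_le_of_plan` repairs at a
cost proportional to the `L¹` error. That error is small because, given the edge `(a, z)`, the
number of short paths from `z` to `b` concentrates (`integral_paths₂_defect_le`,
`integral_paths₃_defect_le`). No matching or Hall-type theorem is needed. Markov's inequality
concludes.

When `n p` has a finite limit, cycles of length at most five through `(a, b)` disappear in
probability, and without them `ricci_eq_of_no_short_cycle` gives the curvature exactly in terms of
the two degrees. If the limit is 0, with high probability neither endpoint has another neighbour; if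
it is positive, the numbers of further neighbours are independent binomials, which become Poisson.
-/

namespace GraphCurvature

/-! ### The law of the graph given the edge, and weighted second moments of subgraph counts -/

section Law

variable {V : Type*}

instance [Finite V] : MeasurableSingletonClass (SimpleGraph V) where
  measurableSet_singleton G := by
    rw [← SimpleGraph.measurableEmbedding_edgeSet.measurableSet_image, Set.image_singleton]
    exact measurableSet_singleton _

/-- The real-valued indicator of the event that all edges in `S` are present. -/
noncomputable def edgeMonomial (S : Finset (Sym2 V)) (G : SimpleGraph V) : ℝ :=
  {G : SimpleGraph V | (S : Set (Sym2 V)) ⊆ G.edgeSet}.indicator 1 G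

/-- The real-valued indicator of adjacency. -/
noncomputable def adjInd (G : SimpleGraph V) (u v : V) : ℝ :=
  edgeMonomial {s(u, v)} G

/-- None of the edges in `S` is a loop or the edge `(a, b)`. -/
def IsFree (a b : V) (S : Finset (Sym2 V)) : Prop :=
  ∀ e ∈ S, ¬ e.IsDiag ∧ e ≠ s(a, b)

/-- In the random graph with law `P` the edge `(a, b)` is present, and all others are present
independently with probability `p`. -/
structure IsEdgeLaw [Fintype V] (P : Measure (SimpleGraph V)) (p : ℝ) (a b : V) : Prop where
  ne : a ≠ b
  pos : 0 < p
  le_one : p ≤ 1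
  ae_adj : ∀ᵐ G ∂P, G.Adj a b
  measureReal_subset : ∀ S : Finset (Sym2 V), IsFree a b S →
    P.real {G | (S : Set (Sym2 V)) ⊆ G.edgeSet} = p ^ S.card

theorem IsFree.symm {a b : V} {S : Finset (Sym2 V)} (h : IsFree a b S) : IsFree b a S := by
  intro e he
  rw [Sym2.eq_swap]
  exact h e he

theorem IsEdgeLaw.symm [Fintype V] {P : Measure (SimpleGraph V)} {p : ℝ} {a b : V}
    (h : IsEdgeLaw P p a b) : IsEdgeLaw P p b a where
  ne := h.ne.symm
  pos := h.pos
  le_one := h.le_one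
  ae_adj := h.ae_adj.mono fun _ hG ↦ hG.symm
  measureReal_subset S hS := h.measureReal_subset S hS.symm

open Classical in
theorem edgeMonomial_apply (S : Finset (Sym2 V)) (G : SimpleGraph V) :
    edgeMonomial S G = if (S : Set (Sym2 V)) ⊆ G.edgeSet then 1 else 0 := by
  simp [edgeMonomial, Set.indicator_apply]

open Classical in
theorem adjInd_apply (G : SimpleGraph V) (u v : V) :
    adjInd G u v = if G.Adj u v then 1 else 0 := by
  simp [adjInd, edgeMonomial_apply]

theorem adjInd_symm (G : SimpleGraph V) (u v : V) : adjInd G u v = adjInd G v u := by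
  rw [adjInd, Sym2.eq_swap, adjInd]

theorem adjInd_of_adj {G : SimpleGraph V} {u v : V} (h : G.Adj u v) : adjInd G u v = 1 := by
  simp [adjInd_apply, h]

theorem adjInd_of_not_adj {G : SimpleGraph V} {u v : V} (h : ¬ G.Adj u v) : adjInd G u v = 0 := by
  simp [adjInd_apply, h]

@[simp]
theorem adjInd_self (G : SimpleGraph V) (u : V) : adjInd G u u = 0 := by
  simp [adjInd_apply]

theorem adjInd_nonneg (G : SimpleGraph V) (u v : V) : 0 ≤ adjInd G u v := by
  rw [adjInd_apply]; split_ifs <;> norm_num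

theorem adjInd_le_one (G : SimpleGraph V) (u v : V) : adjInd G u v ≤ 1 := by
  rw [adjInd_apply]; split_ifs <;> norm_num

theorem edgeMonomial_nonneg (S : Finset (Sym2 V)) (G : SimpleGraph V) :
    0 ≤ edgeMonomial S G := by
  rw [edgeMonomial_apply]; split_ifs <;> norm_num

@[simp]
theorem edgeMonomial_empty (G : SimpleGraph V) : edgeMonomial ∅ G = 1 := by
  simp [edgeMonomial_apply]

theorem edgeMonomial_mul [DecidableEq V] (S T : Finset (Sym2 V)) (G : SimpleGraph V) :
    edgeMonomial S G * edgeMonomial T G = edgeMonomial (S ∪ T) G := by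
  simp only [edgeMonomial_apply, Finset.coe_union, Set.union_subset_iff]
  split_ifs <;> simp_all

theorem edgeMonomial_singleton (u v : V) (G : SimpleGraph V) :
    edgeMonomial {s(u, v)} G = adjInd G u v := rfl

theorem edgeMonomial_insert [DecidableEq V] (u v : V) (S : Finset (Sym2 V)) (G : SimpleGraph V) :
    edgeMonomial (insert s(u, v) S) G = adjInd G u v * edgeMonomial S G := by
  rw [Finset.insert_eq, ← edgeMonomial_mul, edgeMonomial_singleton]

theorem isFree_empty (a b : V) : IsFree a b ∅ := by simp [IsFree]

theorem IsFree.union [DecidableEq V] {a b : V} {S T : Finset (Sym2 V)} (hS : IsFree a b S)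
    (hT : IsFree a b T) : IsFree a b (S ∪ T) := by
  intro e he
  rcases Finset.mem_union.1 he with h | h
  exacts [hS e h, hT e h]

theorem binomialRandom_real_subset [Fintype V] (p : I) (S : Finset (Sym2 V))
    (hS : ∀ e ∈ S, ¬ e.IsDiag) :
    (SimpleGraph.binomialRandom V p).real {G | (S : Set (Sym2 V)) ⊆ G.edgeSet} =
      (p : ℝ) ^ S.card := by
  have hm : MeasurableSet {G : SimpleGraph V | (S : Set (Sym2 V)) ⊆ G.edgeSet} :=
    (Set.toFinite _).measurableSet
  rw [measureReal_def, SimpleGraph.binomialRandom_eq_map,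
    Measure.map_apply SimpleGraph.measurable_fromEdgeSet hm, setBernoulli_apply']
  have : (fun q : Sym2 V → Prop ↦ {i | q i}) ⁻¹' (SimpleGraph.fromEdgeSet ⁻¹'
      {G : SimpleGraph V | (S : Set (Sym2 V)) ⊆ G.edgeSet}) =
      Set.pi (S : Set (Sym2 V)) fun _ ↦ {True} := by
    ext q
    simp only [Set.mem_preimage, Set.mem_ofPred_eq, Set.mem_pi, Set.mem_singleton_iff,
      SimpleGraph.edgeSet_fromEdgeSet, Set.subset_def, Set.mem_sdiff, Finset.mem_coe, eq_iff_iff,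
      iff_true]
    exact ⟨fun h e he ↦ (h e he).1, fun h e he ↦ ⟨h e he, by simpa using hS e he⟩⟩
  rw [this, Measure.infinitePi_pi _ (fun _ _ ↦ .of_discrete)]
  rw [Finset.prod_congr rfl (g := fun _ ↦ ((toNNReal p : ℝ≥0) : ℝ≥0∞))]
  · simp
  · intro e he
    simp [hS e he]

/-- Conditioning divides `p ^ (S.card + 1)` by `p`, because a free set `S` does not contain `s(a,
b)`. Everything later uses only `IsEdgeLaw`. -/
theorem isEdgeLaw_erdosRenyiGivenEdge [Fintype V] (p : I) (hp : 0 < p) (a b : V) (hab : a ≠ b) :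
    IsEdgeLaw (erdosRenyiGivenEdge V p hp a b hab : Measure (SimpleGraph V)) p a b := by
  classical
  have hm : MeasurableSet {G : SimpleGraph V | G.Adj a b} := (Set.toFinite _).measurableSet
  refine ⟨hab, hp, p.2.2, ?_, ?_⟩
  · exact ae_cond_mem hm
  · intro S hS
    have h1 : {G : SimpleGraph V | G.Adj a b} =
        {G : SimpleGraph V | (({s(a, b)} : Finset (Sym2 V)) : Set (Sym2 V)) ⊆ G.edgeSet} := by
      ext G; simp
    have h2 : {G : SimpleGraph V | G.Adj a b} ∩ {G | (S : Set (Sym2 V)) ⊆ G.edgeSet} =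
        {G : SimpleGraph V | ((insert s(a, b) S : Finset (Sym2 V)) : Set (Sym2 V)) ⊆ G.edgeSet} := by
      ext G; simp [Set.insert_subset_iff]
    have h3 : s(a, b) ∉ S := fun h ↦ (hS _ h).2 rfl
    have hp' : (p : ℝ) ≠ 0 := fun h ↦ hp.ne' (Subtype.ext h)
    change ((SimpleGraph.binomialRandom V p)[|{G | G.Adj a b}]).real _ = _
    rw [measureReal_def, cond_apply hm, ENNReal.toReal_mul, ENNReal.toReal_inv, ← measureReal_def,
      ← measureReal_def, h2, h1, binomialRandom_real_subset, binomialRandom_real_subset,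
      Finset.card_insert_of_notMem h3]
    · simp
      field_simp
      ring
    · intro e he
      rcases Finset.mem_insert.1 he with rfl | he
      · simpa using hab
      · exact (hS e he).1
    · simpa using hab

namespace IsEdgeLaw

variable [Fintype V] {P : Measure (SimpleGraph V)} {p : ℝ} {a b : V}

theorem integral_edgeMonomial (h : IsEdgeLaw P p a b) {S : Finset (Sym2 V)} (hS : IsFree a b S) :
    ∫ G, edgeMonomial S G ∂P = p ^ S.card := by
  rw [← h.measureReal_subset S hS]
  exact integral_indicator_one (Set.toFinite _).measurableSet

variable [IsProbabilityMeasure P]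

/-- Expand the square into pairs. For disjoint `S i`, `S j` the four terms cancel exactly by
independence; for overlapping pairs the negative remainder is dropped. The weight `edgeMonomial F`
does not interfere since `F` is disjoint from every `S i`; in applications it records that `z` is a
neighbour of `a`. -/
theorem integral_edgeMonomial_mul_sq_le [DecidableEq V] (h : IsEdgeLaw P p a b) {ι : Type*}
    (J : Finset ι) (S : ι → Finset (Sym2 V)) (k : ℕ) (hk : ∀ i ∈ J, (S i).card = k)
    (hS : ∀ i ∈ J, IsFree a b (S i)) {F : Finset (Sym2 V)} (hF : IsFree a b F)
    (hd : ∀ i ∈ J, Disjoint F (S i)) :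
    ∫ G, edgeMonomial F G * (∑ i ∈ J, edgeMonomial (S i) G - J.card * p ^ k) ^ 2 ∂P ≤
      p ^ F.card * ∑ i ∈ J, ∑ j ∈ J,
        if Disjoint (S i) (S j) then 0 else p ^ (S i ∪ S j).card := by
  have key (G : SimpleGraph V) :
      edgeMonomial F G * (∑ i ∈ J, edgeMonomial (S i) G - J.card * p ^ k) ^ 2 =
      ∑ i ∈ J, ∑ j ∈ J, (edgeMonomial (F ∪ (S i ∪ S j)) G - p ^ k * edgeMonomial (F ∪ S i) G
        - p ^ k * edgeMonomial (F ∪ S j) G + p ^ k * p ^ k * edgeMonomial F G) := by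
    have : ∑ i ∈ J, edgeMonomial (S i) G - J.card * p ^ k =
        ∑ i ∈ J, (edgeMonomial (S i) G - p ^ k) := by
      simp [Finset.sum_sub_distrib]
    rw [this, sq, Finset.sum_mul_sum, Finset.mul_sum]
    refine Finset.sum_congr rfl fun i _ ↦ ?_
    rw [Finset.mul_sum]
    refine Finset.sum_congr rfl fun j _ ↦ ?_
    simp only [← edgeMonomial_mul]
    ring
  simp_rw [key]
  rw [integral_finsetSum _ (fun _ _ ↦ .of_finite), Finset.mul_sum]
  refine Finset.sum_le_sum fun i hi ↦ ?_
  rw [integral_finsetSum _ (fun _ _ ↦ .of_finite), Finset.mul_sum]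
  refine Finset.sum_le_sum fun j hj ↦ ?_
  rw [integral_add .of_finite .of_finite, integral_sub .of_finite .of_finite,
    integral_sub .of_finite .of_finite, integral_const_mul, integral_const_mul, integral_const_mul,
    h.integral_edgeMonomial (hF.union ((hS i hi).union (hS j hj))),
    h.integral_edgeMonomial (hF.union (hS i hi)), h.integral_edgeMonomial (hF.union (hS j hj)),
    h.integral_edgeMonomial hF, Finset.card_union_of_disjoint (hd i hi),
    Finset.card_union_of_disjoint (hd j hj),
    Finset.card_union_of_disjoint (Finset.disjoint_union_right.2 ⟨hd i hi, hd j hj⟩),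
    hk i hi, hk j hj]
  have hp := h.pos
  split_ifs with hij
  · rw [Finset.card_union_of_disjoint hij, hk i hi, hk j hj]
    apply le_of_eq
    ring
  · have : 0 ≤ p ^ F.card * (p ^ k * p ^ k) := by positivity
    simp only [pow_add]
    linarith

/-- Cauchy–Schwarz, in the form `|Y| ≤ t / 2 + Y ^ 2 / (2 * t)` with the optimal `t = √v`. -/
theorem integral_edgeMonomial_mul_abs_le [DecidableEq V] (h : IsEdgeLaw P p a b) {ι : Type*}
    (J : Finset ι) (S : ι → Finset (Sym2 V)) (k : ℕ) (hk : ∀ i ∈ J, (S i).card = k)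
    (hS : ∀ i ∈ J, IsFree a b (S i)) {F : Finset (Sym2 V)} (hF : IsFree a b F)
    (hd : ∀ i ∈ J, Disjoint F (S i)) {v : ℝ} (hv : 0 ≤ v)
    (hle : ∑ i ∈ J, ∑ j ∈ J, (if Disjoint (S i) (S j) then 0 else p ^ (S i ∪ S j).card) ≤ v) :
    ∫ G, edgeMonomial F G * |∑ i ∈ J, edgeMonomial (S i) G - J.card * p ^ k| ∂P ≤
      p ^ F.card * √v := by
  have hp := h.pos
  have h2 := (h.integral_edgeMonomial_mul_sq_le J S k hk hS hF hd).trans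
    (mul_le_mul_of_nonneg_left hle (by positivity))
  set Y : SimpleGraph V → ℝ := fun G ↦ ∑ i ∈ J, edgeMonomial (S i) G - J.card * p ^ k
  have main (t : ℝ) (ht : 0 < t) :
      ∫ G, edgeMonomial F G * |Y G| ∂P ≤ p ^ F.card * (t / 2 + v / (2 * t)) := by
    calc ∫ G, edgeMonomial F G * |Y G| ∂P
        ≤ ∫ G, (t / 2 * edgeMonomial F G + 1 / (2 * t) * (edgeMonomial F G * Y G ^ 2)) ∂P := by
          refine integral_mono .of_finite .of_finite fun G ↦ ?_
          have h3 : |Y G| ≤ t / 2 + 1 / (2 * t) * Y G ^ 2 := by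
            rw [← sq_abs]
            have : t / 2 + 1 / (2 * t) * |Y G| ^ 2 - |Y G| = (|Y G| - t) ^ 2 / (2 * t) := by
              field_simp; ring
            have : 0 ≤ (|Y G| - t) ^ 2 / (2 * t) := by positivity
            linarith
          have := mul_le_mul_of_nonneg_left h3 (edgeMonomial_nonneg F G)
          dsimp only
          linarith
      _ = t / 2 * p ^ F.card + 1 / (2 * t) * ∫ G, edgeMonomial F G * Y G ^ 2 ∂P := by
          rw [integral_add .of_finite .of_finite, integral_const_mul, integral_const_mul,
            h.integral_edgeMonomial hF]
      _ ≤ t / 2 * p ^ F.card + 1 / (2 * t) * (p ^ F.card * v) := by gcongr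
      _ = _ := by field_simp
  -- For `v = 0` the optimal `t` would be zero, so `t` is made arbitrarily small instead.
  rcases hv.eq_or_lt with rfl | hv
  · refine le_of_forall_pos_le_add fun ε hε ↦ ?_
    have := main (2 * (ε / p ^ F.card)) (by positivity)
    refine this.trans (le_of_eq ?_)
    rw [zero_div, add_zero]
    field_simp
    simp
  · refine (main (√v) (Real.sqrt_pos.2 hv)).trans (le_of_eq ?_)
    have h4 : √v ≠ 0 := (Real.sqrt_pos.2 hv).ne'
    have h5 : v = √v * √v := (Real.mul_self_sqrt hv.le).symm
    have h6 : v / (2 * √v) = √v / 2 := by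
      nth_rewrite 1 [h5]
      field_simp
    rw [h6]; ring

end IsEdgeLaw

end Law

/-! ### Transport distance: weak duality and approximate plans -/

section Transport

variable {V : Type*} [Fintype V] {G : SimpleGraph V}

theorem IsCoupling.cost_nonneg {m₁ m₂ : V → ℝ} {ν : V → V → ℝ} (h : IsCoupling m₁ m₂ ν)
    (G : SimpleGraph V) : 0 ≤ ∑ x, ∑ y, ν x y * (G.dist x y : ℝ) :=
  Finset.sum_nonneg fun x _ ↦ Finset.sum_nonneg fun y _ ↦ mul_nonneg (h.nonneg x y) (by positivity)

theorem transportDist_le_cost {m₁ m₂ : V → ℝ} {ν : V → V → ℝ} (h : IsCoupling m₁ m₂ ν)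
    (G : SimpleGraph V) : transportDist G m₁ m₂ ≤ ∑ x, ∑ y, ν x y * (G.dist x y : ℝ) := by
  refine csInf_le ⟨0, ?_⟩ ⟨ν, h, rfl⟩
  rintro c ⟨ν', h', rfl⟩
  exact h'.cost_nonneg G

theorem isCoupling_mul {m₁ m₂ : V → ℝ} (h₁ : ∀ x, 0 ≤ m₁ x) (h₂ : ∀ x, 0 ≤ m₂ x)
    (s₁ : ∑ x, m₁ x = 1) (s₂ : ∑ x, m₂ x = 1) :
    IsCoupling m₁ m₂ fun x y ↦ m₁ x * m₂ y where
  nonneg x y := mul_nonneg (h₁ x) (h₂ y)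
  fst_marginal x := by rw [← Finset.mul_sum, s₂, mul_one]
  snd_marginal y := by rw [← Finset.sum_mul, s₁, one_mul]

/-- Weak Kantorovich duality. -/
theorem le_transportDist {m₁ m₂ : V → ℝ} (h₁ : ∀ x, 0 ≤ m₁ x) (h₂ : ∀ x, 0 ≤ m₂ x)
    (s₁ : ∑ x, m₁ x = 1) (s₂ : ∑ x, m₂ x = 1) {φ ψ : V → ℝ}
    (h : ∀ x y, m₁ x ≠ 0 → m₂ y ≠ 0 → φ x + ψ y ≤ G.dist x y) :
    ∑ x, m₁ x * φ x + ∑ y, m₂ y * ψ y ≤ transportDist G m₁ m₂ := by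
  refine le_csInf ⟨_, _, isCoupling_mul h₁ h₂ s₁ s₂, rfl⟩ ?_
  rintro c ⟨ν, hν, rfl⟩
  have e₁ : ∑ x, m₁ x * φ x = ∑ x, ∑ y, ν x y * φ x := by
    refine Finset.sum_congr rfl fun x _ ↦ ?_
    rw [← Finset.sum_mul, hν.fst_marginal]
  have e₂ : ∑ y, m₂ y * ψ y = ∑ x, ∑ y, ν x y * ψ y := by
    rw [Finset.sum_comm]
    refine Finset.sum_congr rfl fun y _ ↦ ?_
    rw [← Finset.sum_mul, hν.snd_marginal]
  rw [e₁, e₂, ← Finset.sum_add_distrib]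
  refine Finset.sum_le_sum fun x _ ↦ ?_
  rw [← Finset.sum_add_distrib]
  refine Finset.sum_le_sum fun y _ ↦ ?_
  rw [← mul_add]
  rcases (hν.nonneg x y).eq_or_lt with h0 | h0
  · simp [← h0]
  · refine mul_le_mul_of_nonneg_left (h x y ?_ ?_) h0.le
    · rw [← hν.fst_marginal x]
      exact (h0.trans_le (Finset.single_le_sum (fun y _ ↦ hν.nonneg x y) (Finset.mem_univ y))).ne'
    · rw [← hν.snd_marginal y]
      exact (h0.trans_le (Finset.single_le_sum (f := fun x ↦ ν x y) (fun x _ ↦ hν.nonneg x y)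
        (Finset.mem_univ x))).ne'

/-- A nonnegative transport plan with almost the right marginals bounds the transport distance. -/
theorem transportDist_le_of_plan {m₁ m₂ : V → ℝ} (h₁ : ∀ x, 0 ≤ m₁ x) (h₂ : ∀ x, 0 ≤ m₂ x)
    (s₁ : ∑ x, m₁ x = 1) (s₂ : ∑ x, m₂ x = 1) {D : ℝ}
    (hD : ∀ x y, m₁ x ≠ 0 → m₂ y ≠ 0 → (G.dist x y : ℝ) ≤ D)
    {T : V → V → ℝ} (hT : ∀ x y, 0 ≤ T x y) :
    transportDist G m₁ m₂ ≤ ∑ x, ∑ y, T x y * (G.dist x y : ℝ) +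
      D * (∑ x, |m₁ x - ∑ y, T x y| + ∑ y, |m₂ y - ∑ x, T x y|) := by
  have hD0 : 0 ≤ D := by
    obtain ⟨x, -, hx⟩ := Finset.exists_ne_zero_of_sum_ne_zero (s₁.trans_ne one_ne_zero)
    obtain ⟨y, -, hy⟩ := Finset.exists_ne_zero_of_sum_ne_zero (s₂.trans_ne one_ne_zero)
    exact (Nat.cast_nonneg _).trans (hD x y hx hy)
  set r : V → ℝ := fun x ↦ ∑ y, T x y with hr
  set c : V → ℝ := fun y ↦ ∑ x, T x y with hc
  have hr0 x : 0 ≤ r x := Finset.sum_nonneg fun y _ ↦ hT x y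
  have hc0 y : 0 ≤ c y := Finset.sum_nonneg fun x _ ↦ hT x y
  -- For `r = 0` the convention `m / 0 = 0` makes the factor zero, and the identity still holds.
  have clip (m r : ℝ) (hm : 0 ≤ m) (hr : 0 ≤ r) :
      0 ≤ min 1 (m / r) ∧ min 1 (m / r) ≤ 1 ∧ min 1 (m / r) * r = min r m := by
    refine ⟨le_min zero_le_one (by positivity), min_le_left _ _, ?_⟩
    rcases hr.eq_or_lt with rfl | hr
    · simp [hm]
    · rw [min_mul_of_nonneg _ _ hr.le, one_mul, div_mul_cancel₀ _ hr.ne']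
  set α : V → ℝ := fun x ↦ min 1 (m₁ x / r x)
  set β : V → ℝ := fun y ↦ min 1 (m₂ y / c y)
  have hα x := clip (m₁ x) (r x) (h₁ x) (hr0 x)
  have hβ y := clip (m₂ y) (c y) (h₂ y) (hc0 y)
  change ∀ x, 0 ≤ α x ∧ α x ≤ 1 ∧ α x * r x = _ at hα
  change ∀ x, 0 ≤ β x ∧ β x ≤ 1 ∧ β x * c x = _ at hβ
  set ν₀ : V → V → ℝ := fun x y ↦ T x y * (α x * β y) with hν₀
  have hν₀0 x y : 0 ≤ ν₀ x y := mul_nonneg (hT x y) (mul_nonneg (hα x).1 (hβ y).1)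
  have hν₀T x y : ν₀ x y ≤ T x y :=
    mul_le_of_le_one_right (hT x y) (mul_le_one₀ (hα x).2.1 (hβ y).1 (hβ y).2.1)
  have hrow x : ∑ y, ν₀ x y ≤ m₁ x := by
    calc ∑ y, ν₀ x y ≤ ∑ y, α x * T x y := by
          refine Finset.sum_le_sum fun y _ ↦ ?_
          rw [hν₀, mul_comm (α x)]
          refine mul_le_mul_of_nonneg_left ?_ (hT x y)
          exact mul_le_of_le_one_right (hα x).1 (hβ y).2.1
      _ = α x * r x := by rw [← Finset.mul_sum]
      _ ≤ m₁ x := (hα x).2.2.trans_le (min_le_right _ _)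
  have hcol y : ∑ x, ν₀ x y ≤ m₂ y := by
    calc ∑ x, ν₀ x y ≤ ∑ x, β y * T x y := by
          refine Finset.sum_le_sum fun x _ ↦ ?_
          rw [hν₀, mul_comm (β y)]
          refine mul_le_mul_of_nonneg_left ?_ (hT x y)
          exact mul_le_of_le_one_left (hβ y).1 (hα x).2.1
      _ = β y * c y := by rw [← Finset.mul_sum]
      _ ≤ m₂ y := (hβ y).2.2.trans_le (min_le_right _ _)
  set ρ₁ : V → ℝ := fun x ↦ m₁ x - ∑ y, ν₀ x y with hρ₁
  set ρ₂ : V → ℝ := fun y ↦ m₂ y - ∑ x, ν₀ x y with hρ₂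
  have hρ₁0 x : 0 ≤ ρ₁ x := sub_nonneg.2 (hrow x)
  have hρ₂0 y : 0 ≤ ρ₂ y := sub_nonneg.2 (hcol y)
  set K : ℝ := 1 - ∑ x, ∑ y, ν₀ x y with hK
  have sρ₁ : ∑ x, ρ₁ x = K := by rw [hρ₁, Finset.sum_sub_distrib, s₁]
  have sρ₂ : ∑ y, ρ₂ y = K := by rw [hρ₂, Finset.sum_sub_distrib, s₂, Finset.sum_comm]
  have hK0 : 0 ≤ K := sρ₁ ▸ Finset.sum_nonneg fun x _ ↦ hρ₁0 x
  -- If `K = 0` both leftovers vanish, so division by zero does no harm.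
  have hρK (ρ : V → ℝ) (h0 : ∀ x, 0 ≤ ρ x) (hs : ∑ x, ρ x = K) (x : V) : ρ x * K / K = ρ x := by
    rcases hK0.eq_or_lt with h | h
    · rw [← h] at hs
      rw [(Finset.sum_eq_zero_iff_of_nonneg fun x _ ↦ h0 x).1 hs x (Finset.mem_univ x)]
      simp
    · rw [mul_div_cancel_right₀ _ h.ne']
  have hcoup : IsCoupling m₁ m₂ fun x y ↦ ν₀ x y + ρ₁ x * ρ₂ y / K := by
    refine ⟨fun x y ↦ add_nonneg (hν₀0 x y)
      (div_nonneg (mul_nonneg (hρ₁0 x) (hρ₂0 y)) hK0), fun x ↦ ?_, fun y ↦ ?_⟩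
    · rw [Finset.sum_add_distrib, ← Finset.sum_div, ← Finset.mul_sum, sρ₂, hρK ρ₁ hρ₁0 sρ₁]
      simp [hρ₁]
    · rw [Finset.sum_add_distrib, ← Finset.sum_div, ← Finset.sum_mul, sρ₁, mul_comm,
        hρK ρ₂ hρ₂0 sρ₂]
      simp [hρ₂]
  have hKle : K ≤ ∑ x, |m₁ x - r x| + ∑ y, |m₂ y - c y| := by
    have e₁ : ∑ x, ∑ y, T x y = ∑ x, r x := rfl
    -- The mass lost by shrinking: `1 - α β ≤ (1 - α) + (1 - β)` splits it into a row part and a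
    -- column part.
    have e₂ : ∑ x, ∑ y, (T x y - ν₀ x y) ≤
        ∑ x, (r x - min (r x) (m₁ x)) + ∑ y, (c y - min (c y) (m₂ y)) := by
      calc ∑ x, ∑ y, (T x y - ν₀ x y)
          ≤ ∑ x, ∑ y, (T x y * (1 - α x) + T x y * (1 - β y)) := by
            refine Finset.sum_le_sum fun x _ ↦ Finset.sum_le_sum fun y _ ↦ ?_
            have : 0 ≤ T x y * ((1 - α x) * (1 - β y)) :=
              mul_nonneg (hT x y) (mul_nonneg (sub_nonneg.2 (hα x).2.1) (sub_nonneg.2 (hβ y).2.1))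
            simp only [hν₀]
            linarith
        _ = ∑ x, (r x - α x * r x) + ∑ y, (c y - β y * c y) := by
            simp_rw [Finset.sum_add_distrib]
            rw [Finset.sum_comm (f := fun x y ↦ T x y * (1 - β y))]
            simp_rw [← Finset.sum_mul]
            congr 1 <;> refine Finset.sum_congr rfl fun _ _ ↦ ?_
            · simp only [hr]; ring
            · simp only [hc]; ring
        _ = _ := by simp_rw [fun x ↦ (hα x).2.2, fun x ↦ (hβ x).2.2]
    have e₃ : K = ∑ x, (m₁ x - r x) + ∑ x, ∑ y, (T x y - ν₀ x y) := by
      simp_rw [Finset.sum_sub_distrib]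
      rw [e₁, s₁, hK]; ring
    have e₄ : ∑ x, (m₁ x - r x) + ∑ x, (r x - min (r x) (m₁ x)) ≤ ∑ x, |m₁ x - r x| := by
      rw [← Finset.sum_add_distrib]
      refine Finset.sum_le_sum fun x _ ↦ ?_
      rcases le_total (r x) (m₁ x) with h | h
      · rw [min_eq_left h]; linarith [le_abs_self (m₁ x - r x)]
      · rw [min_eq_right h]; linarith [abs_nonneg (m₁ x - r x)]
    have e₅ : ∑ x, (c x - min (c x) (m₂ x)) ≤ ∑ x, |m₂ x - c x| := by
      refine Finset.sum_le_sum fun x _ ↦ ?_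
      rcases le_total (c x) (m₂ x) with h | h
      · rw [min_eq_left h]; simp
      · rw [min_eq_right h]; linarith [neg_le_abs (m₂ x - c x)]
    linarith
  refine (transportDist_le_cost hcoup G).trans ?_
  have f₁ : ∑ x, ∑ y, ν₀ x y * (G.dist x y : ℝ) ≤ ∑ x, ∑ y, T x y * (G.dist x y : ℝ) :=
    Finset.sum_le_sum fun x _ ↦ Finset.sum_le_sum fun y _ ↦
      mul_le_mul_of_nonneg_right (hν₀T x y) (by positivity)
  have f₂ : ∑ x, ∑ y, ρ₁ x * ρ₂ y / K * (G.dist x y : ℝ) ≤ D * K := by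
    calc ∑ x, ∑ y, ρ₁ x * ρ₂ y / K * (G.dist x y : ℝ)
        ≤ ∑ x, ∑ y, ρ₁ x * ρ₂ y / K * D := by
          refine Finset.sum_le_sum fun x _ ↦ Finset.sum_le_sum fun y _ ↦ ?_
          by_cases hx : m₁ x = 0
          · have : ρ₁ x = 0 := le_antisymm (by
              simp only [hρ₁, hx]
              linarith [Finset.sum_nonneg fun y (_ : y ∈ Finset.univ) ↦ hν₀0 x y]) (hρ₁0 x)
            simp [this]
          by_cases hy : m₂ y = 0
          · have : ρ₂ y = 0 := le_antisymm (by
              simp only [hρ₂, hy]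
              linarith [Finset.sum_nonneg fun x (_ : x ∈ Finset.univ) ↦ hν₀0 x y]) (hρ₂0 y)
            simp [this]
          exact mul_le_mul_of_nonneg_left (hD x y hx hy)
            (div_nonneg (mul_nonneg (hρ₁0 x) (hρ₂0 y)) hK0)
      _ = D * K := by
          rw [mul_comm D, ← sρ₁, Finset.sum_mul]
          refine Finset.sum_congr rfl fun x _ ↦ ?_
          rw [← Finset.sum_mul, ← Finset.sum_div, ← Finset.mul_sum, sρ₂, sρ₁, hρK ρ₁ hρ₁0 sρ₁]
  have f₃ := mul_le_mul_of_nonneg_left hKle hD0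
  simp_rw [add_mul, Finset.sum_add_distrib]
  linarith

end Transport

/-! ### Deterministic bounds at an edge: cycle counts below, the path through the edge above -/

section Edge

variable {V : Type*} {G : SimpleGraph V} {a b : V}

/-- The degree of a vertex, as a real number. -/
noncomputable def rdeg (G : SimpleGraph V) (a : V) : ℝ := ((G.neighborSet a).ncard : ℝ)

theorem walkMeasure_eq (G : SimpleGraph V) (a z : V) :
    walkMeasure G a z = adjInd G a z / rdeg G a := by
  classical
  simp only [walkMeasure, adjInd_apply, rdeg]
  split_ifs <;> simp

theorem walkMeasure_nonneg (G : SimpleGraph V) (a z : V) : 0 ≤ walkMeasure G a z := by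
  rw [walkMeasure_eq]
  exact div_nonneg (adjInd_nonneg _ _ _) (Nat.cast_nonneg _)

theorem adj_of_walkMeasure_ne_zero {z : V} (h : walkMeasure G a z ≠ 0) : G.Adj a z := by
  by_contra h'
  simp [walkMeasure, h'] at h

theorem adj_of_adjInd_ne_zero {z : V} (h : adjInd G a z ≠ 0) : G.Adj a z := by
  by_contra h'
  exact h (adjInd_of_not_adj h')

theorem dist_le_two_of_adj {z c w : V} (h₁ : G.Adj z c) (h₂ : G.Adj c w) : G.dist z w ≤ 2 :=
  SimpleGraph.dist_le (.cons h₁ (.cons h₂ .nil))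

theorem dist_le_three (h : G.Adj a b) {z w : V} (hz : G.Adj a z) (hw : G.Adj b w) :
    G.dist z w ≤ 3 :=
  SimpleGraph.dist_le (.cons hz.symm (.cons h (.cons hw .nil)))

/-- The two vertices are connected through `(a, b)`, so `G.dist` is a true distance and a value 0, 1
or 2 yields an actual walk. -/
theorem exists_walk_length_eq_dist (h : G.Adj a b) {z w : V} (hz : G.Adj a z) (hw : G.Adj b w) :
    ∃ q : G.Walk z w, q.length = G.dist z w :=
  SimpleGraph.Reachable.exists_walk_length_eq_dist
    ⟨.cons hz.symm (.cons h (.cons hw .nil))⟩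

variable [Fintype V]

theorem sum_adjInd (G : SimpleGraph V) (a : V) : ∑ z, adjInd G a z = rdeg G a := by
  classical
  simp only [adjInd_apply, rdeg, Finset.sum_boole]
  congr 1
  rw [← Set.ncard_coe_finset]
  congr 1
  ext z; simp

theorem ricci_eq (h : G.Adj a b) :
    ricci G a b = 1 - transportDist G (walkMeasure G a) (walkMeasure G b) := by
  rw [ricci, SimpleGraph.dist_eq_one_iff_adj.2 h]
  simp

theorem transportDist_nonneg (G : SimpleGraph V) (m₁ m₂ : V → ℝ) : 0 ≤ transportDist G m₁ m₂ := by
  apply Real.sInf_nonneg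
  rintro c ⟨ν, h, rfl⟩
  exact h.cost_nonneg G

variable [DecidableEq V]

/-- The vertices other than `a` and `b`. -/
def rest (a b : V) : Finset V := {z | z ≠ a ∧ z ≠ b}

theorem mem_rest {a b z : V} : z ∈ rest a b ↔ z ≠ a ∧ z ≠ b := by simp [rest]

theorem rest_symm (a b : V) : rest a b = rest b a := by
  ext z; simp [mem_rest, and_comm]

theorem card_rest {a b : V} (h : a ≠ b) : (rest a b).card = Fintype.card V - 2 := by
  have : rest a b = Finset.univ \ {a, b} := by ext z; simp [mem_rest]
  rw [this, Finset.card_sdiff_of_subset (Finset.subset_univ _), Finset.card_pair h,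
    Finset.card_univ]

theorem sum_eq_add_rest {a b : V} (h : a ≠ b) (f : V → ℝ) :
    ∑ z, f z = f a + f b + ∑ z ∈ rest a b, f z := by
  have : rest a b = Finset.univ \ {a, b} := by ext z; simp [mem_rest]
  rw [this, ← Finset.sum_pair h, add_comm, Finset.sum_sdiff (Finset.subset_univ _)]

theorem rdeg_eq (h : G.Adj a b) : rdeg G a = 1 + ∑ z ∈ rest a b, adjInd G a z := by
  rw [← sum_adjInd, sum_eq_add_rest h.ne, adjInd_self, adjInd_of_adj h, zero_add]

theorem one_le_rdeg (h : G.Adj a b) : 1 ≤ rdeg G a := by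
  rw [rdeg_eq h]
  linarith [Finset.sum_nonneg fun z (_ : z ∈ rest a b) ↦ adjInd_nonneg G a z]

theorem sum_walkMeasure (h : G.Adj a b) : ∑ z, walkMeasure G a z = 1 := by
  simp_rw [walkMeasure_eq, ← Finset.sum_div, sum_adjInd]
  exact div_self (zero_lt_one.trans_le (one_le_rdeg h)).ne'

/-- The potential is `k` minus the penalty `g`. It must be lowered by `k - 1` at `b` on the `a` side
and at `a` on the `b` side, because these two vertices are adjacent to everything opposite; each
carries mass one over the degree. At the pair `(b, a)` both corrections apply, and `k - 2 * (k - 1)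
≤ 1` holds as `1 ≤ k`. -/
theorem le_transportDist_walkMeasure (h : G.Adj a b) {k : ℝ} (hk : 1 ≤ k) {g : V → ℝ}
    (hg : ∀ z, 0 ≤ g z)
    (hd : ∀ z ∈ rest a b, ∀ w ∈ rest a b, G.Adj a z → G.Adj b w → k - g z ≤ G.dist z w) :
    k - (k - 1) / rdeg G a - (k - 1) / rdeg G b
      - (∑ z ∈ rest a b, adjInd G a z * g z) / rdeg G a ≤
      transportDist G (walkMeasure G a) (walkMeasure G b) := by
  have main := le_transportDist (G := G) (walkMeasure_nonneg G a) (walkMeasure_nonneg G b)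
    (sum_walkMeasure h) (sum_walkMeasure h.symm)
    (φ := fun z ↦ k - (if z = b then k - 1 else 0) - if z ∈ rest a b then g z else 0)
    (ψ := fun w ↦ - if w = a then k - 1 else 0) (by
      intro z w hz hw
      replace hz := adj_of_walkMeasure_ne_zero hz
      replace hw := adj_of_walkMeasure_ne_zero hw
      by_cases hzb : z = b
      · subst hzb
        by_cases hwa : w = a
        · subst hwa
          have : G.dist z w = 1 := SimpleGraph.dist_eq_one_iff_adj.2 hw
          simp [mem_rest, this]; linarith
        · have : G.dist z w = 1 := SimpleGraph.dist_eq_one_iff_adj.2 hw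
          simp [mem_rest, hwa, this]
      · have hzR : z ∈ rest a b := mem_rest.2 ⟨hz.ne', hzb⟩
        by_cases hwa : w = a
        · subst hwa
          have : G.dist z w = 1 := SimpleGraph.dist_eq_one_iff_adj.2 hz.symm
          simp [this, hzR, hzb]; linarith [hg z]
        · have := hd z hzR w (mem_rest.2 ⟨hwa, hw.ne'⟩) hz hw
          simp [hzR, hzb, hwa, this])
  refine le_trans (le_of_eq ?_) main
  have e₂ : ∑ w, walkMeasure G b w * (- if w = a then k - 1 else 0) = - ((k - 1) / rdeg G b) := by
    simp [walkMeasure_eq, adjInd_of_adj h.symm]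
    ring
  rw [e₂]
  simp_rw [mul_sub, Finset.sum_sub_distrib, ← Finset.sum_mul, sum_walkMeasure h]
  have e₁ : ∑ z, walkMeasure G a z * (if z = b then k - 1 else 0) = (k - 1) / rdeg G a := by
    simp [walkMeasure_eq, adjInd_of_adj h]
    ring
  have e₃ : ∑ z, walkMeasure G a z * (if z ∈ rest a b then g z else 0) =
      (∑ z ∈ rest a b, adjInd G a z * g z) / rdeg G a := by
    simp only [mul_ite, mul_zero, Finset.sum_ite_mem, Finset.univ_inter, Finset.sum_div]
    exact Finset.sum_congr rfl fun z _ ↦ by rw [walkMeasure_eq]; ring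
  rw [e₁, e₃]
  ring

/-- Number of triangles on the edge `(a, b)`. -/
noncomputable def triCount (G : SimpleGraph V) (a b : V) : ℝ :=
  ∑ z ∈ rest a b, adjInd G a z * adjInd G b z

/-- Number of paths of length two from `z` to `b` that avoid `a`. -/
noncomputable def paths₂ (G : SimpleGraph V) (a b z : V) : ℝ :=
  ∑ w ∈ (rest a b).erase z, edgeMonomial {s(z, w), s(b, w)} G

/-- Number of paths of length three from `z` to `b` that avoid `a`. -/
noncomputable def paths₃ (G : SimpleGraph V) (a b z : V) : ℝ :=
  ∑ q ∈ ((rest a b).erase z).offDiag, edgeMonomial {s(z, q.1), s(q.1, q.2), s(b, q.2)} G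

/-- Number of cycles of length four through the edge `(a, b)`. -/
noncomputable def quadCount (G : SimpleGraph V) (a b : V) : ℝ :=
  ∑ z ∈ rest a b, adjInd G a z * paths₂ G a b z

/-- Number of cycles of length five through the edge `(a, b)`. -/
noncomputable def pentCount (G : SimpleGraph V) (a b : V) : ℝ :=
  ∑ z ∈ rest a b, adjInd G a z * paths₃ G a b z

theorem paths₂_nonneg (G : SimpleGraph V) (a b z : V) : 0 ≤ paths₂ G a b z :=
  Finset.sum_nonneg fun _ _ ↦ edgeMonomial_nonneg _ _

theorem paths₃_nonneg (G : SimpleGraph V) (a b z : V) : 0 ≤ paths₃ G a b z :=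
  Finset.sum_nonneg fun _ _ ↦ edgeMonomial_nonneg _ _

theorem triCount_nonneg (G : SimpleGraph V) (a b : V) : 0 ≤ triCount G a b :=
  Finset.sum_nonneg fun _ _ ↦ mul_nonneg (adjInd_nonneg _ _ _) (adjInd_nonneg _ _ _)

theorem quadCount_nonneg (G : SimpleGraph V) (a b : V) : 0 ≤ quadCount G a b :=
  Finset.sum_nonneg fun _ _ ↦ mul_nonneg (adjInd_nonneg _ _ _) (paths₂_nonneg _ _ _ _)

theorem pentCount_nonneg (G : SimpleGraph V) (a b : V) : 0 ≤ pentCount G a b :=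
  Finset.sum_nonneg fun _ _ ↦ mul_nonneg (adjInd_nonneg _ _ _) (paths₃_nonneg _ _ _ _)

theorem one_le_paths₂ {z w : V} (hw : w ∈ rest a b) (hzw : G.Adj z w) (hbw : G.Adj b w) :
    1 ≤ paths₂ G a b z := by
  refine le_trans (le_of_eq ?_) (Finset.single_le_sum
    (f := fun w ↦ edgeMonomial {s(z, w), s(b, w)} G) (fun _ _ ↦ edgeMonomial_nonneg _ _)
    (Finset.mem_erase.2 ⟨hzw.ne', hw⟩))
  simp [edgeMonomial_insert, edgeMonomial_singleton, adjInd_of_adj, *]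

theorem one_le_paths₃ {z c w : V} (hc : c ∈ rest a b) (hw : w ∈ rest a b) (hwz : w ≠ z)
    (hzc : G.Adj z c) (hcw : G.Adj c w) (hbw : G.Adj b w) : 1 ≤ paths₃ G a b z := by
  refine le_trans (le_of_eq ?_) (Finset.single_le_sum
    (f := fun q : V × V ↦ edgeMonomial {s(z, q.1), s(q.1, q.2), s(b, q.2)} G)
    (fun _ _ ↦ edgeMonomial_nonneg _ _) (a := (c, w))
    (Finset.mem_offDiag.2 ⟨Finset.mem_erase.2 ⟨hzc.ne', hc⟩, Finset.mem_erase.2 ⟨hwz, hw⟩,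
      hcw.ne⟩))
  simp [edgeMonomial_insert, edgeMonomial_singleton, adjInd_of_adj, *]

theorem one_sub_triCount_le (h : G.Adj a b) :
    1 - triCount G a b / rdeg G a ≤ transportDist G (walkMeasure G a) (walkMeasure G b) := by
  have := le_transportDist_walkMeasure h le_rfl (g := fun z ↦ adjInd G b z)
    (fun z ↦ adjInd_nonneg _ _ _) (by
      intro z hz w hw haz hbw
      obtain ⟨q, hq⟩ := exists_walk_length_eq_dist h haz hbw
      rcases Nat.eq_zero_or_pos (G.dist z w) with h0 | h0
      · have := SimpleGraph.Walk.eq_of_length_eq_zero (hq.trans h0)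
        subst this
        simp [adjInd_of_adj hbw]
      · have : (1 : ℝ) ≤ G.dist z w := by exact_mod_cast h0
        linarith [adjInd_nonneg G b z])
  simpa [triCount] using this

/-- A pair at distance 0 makes `z` a common neighbour and a pair at distance 1 closes a 4-cycle;
either way the penalty at `z` is at least the full value 2. -/
theorem two_sub_quadCount_le (h : G.Adj a b) :
    2 - 1 / rdeg G a - 1 / rdeg G b - (2 * (triCount G a b + quadCount G a b)) / rdeg G a ≤
      transportDist G (walkMeasure G a) (walkMeasure G b) := by
  have := le_transportDist_walkMeasure h one_le_two
    (g := fun z ↦ 2 * (adjInd G b z + paths₂ G a b z))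
    (fun z ↦ by have := adjInd_nonneg G b z; have := paths₂_nonneg G a b z; positivity) (by
      intro z hz w hw haz hbw
      have h1 := adjInd_nonneg G b z
      have h2 := paths₂_nonneg G a b z
      obtain ⟨q, hq⟩ := exists_walk_length_eq_dist h haz hbw
      rcases Nat.lt_or_ge (G.dist z w) 2 with h0 | h0
      · interval_cases hd : G.dist z w
        · have := SimpleGraph.Walk.eq_of_length_eq_zero hq
          subst this
          rw [adjInd_of_adj hbw]
          push_cast; linarith
        · have := one_le_paths₂ hw (SimpleGraph.dist_eq_one_iff_adj.1 hd) hbw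
          push_cast; linarith
      · have : (2 : ℝ) ≤ G.dist z w := by exact_mod_cast h0
        linarith)
  refine le_trans (le_of_eq ?_) this
  have e : ∑ z ∈ rest a b, adjInd G a z * (2 * (adjInd G b z + paths₂ G a b z)) =
      2 * (triCount G a b + quadCount G a b) := by
    rw [triCount, quadCount, ← Finset.sum_add_distrib, Finset.mul_sum]
    exact Finset.sum_congr rfl fun z _ ↦ by ring
  rw [e]
  norm_num

/-- Without triangles on `(a, b)`, the midpoint of a path of length two from `z` to `w` can be
neither `a` nor `b`, so such a path closes a genuine 5-cycle. -/
theorem three_sub_pentCount_le (h : G.Adj a b) (h₀ : triCount G a b = 0) :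
    3 - 2 / rdeg G a - 2 / rdeg G b - (3 * (quadCount G a b + pentCount G a b)) / rdeg G a ≤
      transportDist G (walkMeasure G a) (walkMeasure G b) := by
  have htri z (hz : z ∈ rest a b) (haz : G.Adj a z) (hbz : G.Adj b z) : False := by
    have := (Finset.sum_eq_zero_iff_of_nonneg fun z _ ↦ mul_nonneg (adjInd_nonneg G a z)
      (adjInd_nonneg G b z)).1 h₀ z hz
    simp [adjInd_of_adj, haz, hbz] at this
  have := le_transportDist_walkMeasure h (by norm_num : (1 : ℝ) ≤ 3)
    (g := fun z ↦ 3 * (paths₂ G a b z + paths₃ G a b z))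
    (fun z ↦ by have := paths₃_nonneg G a b z; have := paths₂_nonneg G a b z; positivity) (by
      intro z hz w hw haz hbw
      have h1 := paths₃_nonneg G a b z
      have h2 := paths₂_nonneg G a b z
      obtain ⟨q, hq⟩ := exists_walk_length_eq_dist h haz hbw
      rcases Nat.lt_or_ge (G.dist z w) 3 with h0 | h0
      · interval_cases hd : G.dist z w
        · have := SimpleGraph.Walk.eq_of_length_eq_zero hq
          subst this
          exact (htri z hz haz hbw).elim
        · have := one_le_paths₂ hw (SimpleGraph.dist_eq_one_iff_adj.1 hd) hbw
          push_cast; linarith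
        -- If `c = a` then `w` would be a common neighbour, and if `c = b` then `z` would be one.
        · obtain ⟨c, hzc, hcw⟩ : ∃ c, G.Adj z c ∧ G.Adj c w := by
            match q, hq with
            | .cons h₁ (.cons h₂ .nil), _ => exact ⟨_, h₁, h₂⟩
          have hzw : w ≠ z := by
            rintro rfl
            exact htri w hw haz hbw
          have hca : c ≠ a := by
            rintro rfl
            exact htri w hw hcw hbw
          have hcb : c ≠ b := by
            rintro rfl
            exact htri z hz haz hzc.symm
          have := one_le_paths₃ (mem_rest.2 ⟨hca, hcb⟩) hw hzw hzc hcw hbw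
          push_cast; linarith
      · have : (3 : ℝ) ≤ G.dist z w := by exact_mod_cast h0
        linarith)
  refine le_trans (le_of_eq ?_) this
  have e : ∑ z ∈ rest a b, adjInd G a z * (3 * (paths₂ G a b z + paths₃ G a b z)) =
      3 * (quadCount G a b + pentCount G a b) := by
    rw [quadCount, pentCount, ← Finset.sum_add_distrib, Finset.mul_sum]
    exact Finset.sum_congr rfl fun z _ ↦ by ring
  rw [e]
  norm_num

/-- Mass at `b` moves to the other neighbours of `b`, and mass `1 / rdeg G b` moves from the other
neighbours of `a` to `a`, both at cost 1; the remaining mass travels at most 3. The total is `1 / x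
+ 1 / y + 3 * γ = 1 + 2 * γ` with `γ = 1 - 1 / x - 1 / y`. If an endpoint has degree one, all
distances are at most 1 instead. -/
theorem transportDist_walkMeasure_le (h : G.Adj a b) :
    transportDist G (walkMeasure G a) (walkMeasure G b) ≤
      1 + 2 * max (1 - 1 / rdeg G a - 1 / rdeg G b) 0 := by
  have hda := one_le_rdeg h
  have hdb := one_le_rdeg h.symm
  have hle_one (hd : ∀ z w, G.Adj a z → G.Adj b w → G.dist z w ≤ 1) :
      transportDist G (walkMeasure G a) (walkMeasure G b) ≤ 1 := by
    have hc := isCoupling_mul (walkMeasure_nonneg G a) (walkMeasure_nonneg G b)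
      (sum_walkMeasure h) (sum_walkMeasure h.symm)
    calc _ ≤ _ := transportDist_le_cost hc G
      _ ≤ ∑ z, ∑ w, walkMeasure G a z * walkMeasure G b w := by
        refine Finset.sum_le_sum fun z _ ↦ Finset.sum_le_sum fun w _ ↦ ?_
        by_cases h₁ : walkMeasure G a z = 0
        · simp [h₁]
        by_cases h₂ : walkMeasure G b w = 0
        · simp [h₂]
        refine mul_le_of_le_one_right (hc.nonneg z w) ?_
        exact_mod_cast hd z w (adj_of_walkMeasure_ne_zero h₁) (adj_of_walkMeasure_ne_zero h₂)
      _ = 1 := by rw [← Finset.sum_mul_sum, sum_walkMeasure h, sum_walkMeasure h.symm, mul_one]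
  have hmax : (0 : ℝ) ≤ max (1 - 1 / rdeg G a - 1 / rdeg G b) 0 := le_max_right _ _
  have honly {a b : V} (h : G.Adj a b) (hd : rdeg G a = 1) (z : V) (hz : G.Adj a z) : z = b := by
    by_contra hzb
    have h1 := rdeg_eq h
    have := Finset.single_le_sum (fun z _ ↦ adjInd_nonneg G a z)
      (mem_rest.2 ⟨hz.ne', hzb⟩ : z ∈ rest a b)
    rw [adjInd_of_adj hz] at this
    linarith
  have hnat (a : V) : rdeg G a = 1 ∨ rdeg G a < 1 ∨ 2 ≤ rdeg G a := by
    unfold rdeg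
    norm_cast
    omega
  rcases hnat a with h1 | h1 | h1
  · refine (hle_one fun z w hz hw ↦ ?_).trans (by linarith)
    rw [honly h h1 z hz, SimpleGraph.dist_eq_one_iff_adj.2 hw]
  · linarith
  rcases hnat b with h2 | h2 | h2
  · refine (hle_one fun z w hz hw ↦ ?_).trans (by linarith)
    rw [honly h.symm h2 w hw, SimpleGraph.dist_eq_one_iff_adj.2 hz.symm]
  · linarith
  set x := rdeg G a with hx
  set y := rdeg G b with hy
  set A : V → ℝ := fun z ↦ if z = b then 0 else adjInd G a z with hA
  set B : V → ℝ := fun w ↦ if w = a then 0 else adjInd G b w with hB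
  have hA0 z : 0 ≤ A z := by simp only [hA]; split_ifs <;> simp [adjInd_nonneg]
  have hB0 z : 0 ≤ B z := by simp only [hB]; split_ifs <;> simp [adjInd_nonneg]
  have hAz z : adjInd G a z = A z + if z = b then 1 else 0 := by
    simp only [hA]; split_ifs with hz
    · rw [hz, adjInd_of_adj h, zero_add]
    · simp
  have hBz z : adjInd G b z = B z + if z = a then 1 else 0 := by
    simp only [hB]; split_ifs with hz
    · rw [hz, adjInd_of_adj h.symm, zero_add]
    · simp
  have hsA : ∑ z, A z = x - 1 := by
    rw [hx, ← sum_adjInd]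
    simp_rw [hAz, Finset.sum_add_distrib]
    simp
  have hsB : ∑ z, B z = y - 1 := by
    rw [hy, ← sum_adjInd]
    simp_rw [hBz, Finset.sum_add_distrib]
    simp
  have hγ : 0 ≤ 1 - 1 / x - 1 / y := by
    have : 1 / x ≤ 1 / 2 := one_div_le_one_div_of_le (by norm_num) h1
    have : 1 / y ≤ 1 / 2 := one_div_le_one_div_of_le (by norm_num) h2
    linarith
  rw [max_eq_left hγ]
  set γ := 1 - 1 / x - 1 / y with hγd
  have hx0 : x ≠ 0 := by linarith
  have hy0 : y ≠ 0 := by linarith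
  have hx1 : x - 1 ≠ 0 := by linarith
  have hy1 : y - 1 ≠ 0 := by linarith
  -- Each of the three flows is uniform: masses `1 / x`, `1 / y` and `γ` are spread over `y - 1`, `x
  -- - 1` and `(x - 1) * (y - 1)` pairs.
  set c₁ := 1 / (x * (y - 1)) with hc₁
  set c₂ := 1 / (y * (x - 1)) with hc₂
  set c₃ := γ / ((x - 1) * (y - 1)) with hc₃
  have hc₁0 : 0 ≤ c₁ := div_nonneg zero_le_one (mul_nonneg (by linarith) (by linarith))
  have hc₂0 : 0 ≤ c₂ := div_nonneg zero_le_one (mul_nonneg (by linarith) (by linarith))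
  have hc₃0 : 0 ≤ c₃ := div_nonneg hγ (mul_nonneg (by linarith) (by linarith))
  set β : V → ℝ := fun z ↦ if z = b then 1 else 0 with hβ
  set α : V → ℝ := fun z ↦ if z = a then 1 else 0 with hα
  have hβ0 z : 0 ≤ β z := by simp only [hβ]; split_ifs <;> norm_num
  have hα0 z : 0 ≤ α z := by simp only [hα]; split_ifs <;> norm_num
  have hsβ : ∑ z, β z = 1 := by simp [hβ]
  have hsα : ∑ z, α z = 1 := by simp [hα]
  have hcoup : IsCoupling (walkMeasure G a) (walkMeasure G b) fun z w ↦
      c₁ * (β z * B w) + c₂ * (A z * α w) + c₃ * (A z * B w) := by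
    refine ⟨fun z w ↦ ?_, fun z ↦ ?_, fun w ↦ ?_⟩
    · have := hA0 z; have := hB0 w; have := hα0 w; have := hβ0 z
      positivity
    · simp_rw [Finset.sum_add_distrib, ← Finset.mul_sum, hsB, hsα, walkMeasure_eq, hAz]
      rw [← hx, hc₁, hc₂, hc₃, hγd]
      field_simp
      ring
    · simp_rw [Finset.sum_add_distrib, ← Finset.mul_sum, ← Finset.sum_mul, hsA, hsβ,
        walkMeasure_eq, hBz]
      rw [← hy, hc₁, hc₂, hc₃, hγd]
      field_simp
      ring
  refine (transportDist_le_cost hcoup G).trans ?_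
  calc _ ≤ ∑ z, ∑ w, (c₁ * (β z * B w) + c₂ * (A z * α w) + c₃ * (A z * B w) * 3) := by
        refine Finset.sum_le_sum fun z _ ↦ Finset.sum_le_sum fun w _ ↦ ?_
        rw [add_mul, add_mul]
        gcongr ?_ + ?_ + ?_
        · by_cases hz : z = b
          · by_cases hw : B w = 0
            · simp [hw]
            · have : G.Adj b w := by
                apply adj_of_adjInd_ne_zero
                simp only [hB] at hw
                split_ifs at hw with h'
                · exact (hw rfl).elim
                · exact hw
              rw [hz, SimpleGraph.dist_eq_one_iff_adj.2 this]; simp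
          · simp [hβ, hz]
        · by_cases hw : w = a
          · by_cases hz : A z = 0
            · simp [hz]
            · have : G.Adj a z := by
                apply adj_of_adjInd_ne_zero
                simp only [hA] at hz
                split_ifs at hz with h'
                · exact (hz rfl).elim
                · exact hz
              rw [hw, SimpleGraph.dist_eq_one_iff_adj.2 this.symm]; simp
          · simp [hα, hw]
        · by_cases hz : adjInd G a z = 0
          · have : A z = 0 := by simp [hA, hz]
            simp [this]
          by_cases hw : adjInd G b w = 0
          · have : B w = 0 := by simp [hB, hw]
            simp [this]
          refine mul_le_mul_of_nonneg_left ?_ (mul_nonneg hc₃0 (mul_nonneg (hA0 z) (hB0 w)))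
          exact_mod_cast dist_le_three h (adj_of_adjInd_ne_zero hz) (adj_of_adjInd_ne_zero hw)
    _ = 1 + 2 * γ := by
        simp_rw [Finset.sum_add_distrib, ← Finset.sum_mul, ← Finset.mul_sum, ← Finset.sum_mul, hsA,
          hsB, hsα, hsβ]
        rw [hc₁, hc₂, hc₃]
        field_simp
        rw [hγd]
        field_simp
        ring

theorem transportDist_walkMeasure_le_three (h : G.Adj a b) :
    transportDist G (walkMeasure G a) (walkMeasure G b) ≤ 3 := by
  refine (transportDist_walkMeasure_le h).trans ?_
  have h1 : 0 < rdeg G a := zero_lt_one.trans_le (one_le_rdeg h)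
  have h2 : 0 < rdeg G b := zero_lt_one.trans_le (one_le_rdeg h.symm)
  have : max (1 - 1 / rdeg G a - 1 / rdeg G b) 0 ≤ 1 := by
    refine max_le ?_ zero_le_one
    have : 0 < 1 / rdeg G a := by positivity
    have : 0 < 1 / rdeg G b := by positivity
    linarith
  linarith

/-- The curvature of an edge that lies on no cycle of length at most five. -/
theorem ricci_eq_of_no_short_cycle (h : G.Adj a b) (h₃ : triCount G a b = 0)
    (h₄ : quadCount G a b = 0) (h₅ : pentCount G a b = 0) :
    ricci G a b = -2 * max (1 - 1 / rdeg G a - 1 / rdeg G b) 0 := by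
  have l₁ := one_sub_triCount_le h
  have l₃ := three_sub_pentCount_le h h₃
  have u := transportDist_walkMeasure_le h
  rw [h₃, zero_div, sub_zero] at l₁
  rw [h₄, h₅, add_zero, mul_zero, zero_div, sub_zero] at l₃
  rw [ricci_eq h]
  rcases max_cases (1 - 1 / rdeg G a - 1 / rdeg G b) 0 with ⟨hm, -⟩ | ⟨hm, -⟩ <;> rw [hm] at u ⊢
  · have e₁ : 2 / rdeg G a = 2 * (1 / rdeg G a) := by ring
    have e₂ : 2 / rdeg G b = 2 * (1 / rdeg G b) := by ring
    linarith
  · linarith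

end Edge

/-! ### Plans that spread mass along short paths -/

section Plans

variable {V : Type*} [Fintype V] [DecidableEq V] {G : SimpleGraph V} {a b : V}

/-- A bound for the total variation between the walk distribution at `a` and a mass function that
is `ρ z / x` on the neighbours `z ≠ b` of `a`. -/
noncomputable def rowDefect (G : SimpleGraph V) (a b : V) (x : ℝ) (ρ : V → ℝ) : ℝ :=
  |1 - rdeg G a / x| + 1 / x + (∑ z ∈ rest a b, adjInd G a z * |1 - ρ z|) / x

theorem rowDefect_mono {x : ℝ} (hx : 0 < x) {ρ ρ' : V → ℝ} (h : ∀ z, |1 - ρ z| ≤ |1 - ρ' z|) :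
    rowDefect G a b x ρ ≤ rowDefect G a b x ρ' := by
  have : ∑ z ∈ rest a b, adjInd G a z * |1 - ρ z| ≤ ∑ z ∈ rest a b, adjInd G a z * |1 - ρ' z| :=
    Finset.sum_le_sum fun z _ ↦ mul_le_mul_of_nonneg_left (h z) (adjInd_nonneg _ _ _)
  unfold rowDefect
  gcongr

theorem abs_one_sub_add_le_rowDefect (G : SimpleGraph V) (a b : V) {x : ℝ} (hx : 0 < x)
    (ρ : V → ℝ) : |1 - rdeg G a / x| + 1 / x ≤ rowDefect G a b x ρ :=
  le_add_of_nonneg_right (div_nonneg (Finset.sum_nonneg fun _ _ ↦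
    mul_nonneg (adjInd_nonneg _ _ _) (abs_nonneg _)) hx.le)

theorem abs_one_sub_le_rowDefect (G : SimpleGraph V) (a b : V) {x : ℝ} (hx : 0 < x)
    (ρ : V → ℝ) : |1 - rdeg G a / x| ≤ rowDefect G a b x ρ :=
  (le_add_of_nonneg_right (by positivity)).trans (abs_one_sub_add_le_rowDefect G a b hx ρ)

/-- The three terms of `rowDefect` are the error of replacing the degree by `x`, the mass at `b`,
which the plan ignores, and the error of the row sums. -/
theorem sum_abs_walkMeasure_sub_le (h : G.Adj a b) {x : ℝ} (hx : 0 < x) {r ρ : V → ℝ}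
    (hr : ∀ z, r z = if z ∈ rest a b then adjInd G a z * ρ z / x else 0) :
    ∑ z, |walkMeasure G a z - r z| ≤ rowDefect G a b x ρ := by
  have hd : 0 < rdeg G a := zero_lt_one.trans_le (one_le_rdeg h)
  calc ∑ z, |walkMeasure G a z - r z|
      ≤ ∑ z, (adjInd G a z * |1 / rdeg G a - 1 / x| + |adjInd G a z / x - r z|) := by
        refine Finset.sum_le_sum fun z _ ↦ ?_
        rw [walkMeasure_eq]
        have : adjInd G a z / rdeg G a - r z =
            adjInd G a z * (1 / rdeg G a - 1 / x) + (adjInd G a z / x - r z) := by ring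
        rw [this]
        refine (abs_add_le _ _).trans ?_
        rw [abs_mul, abs_of_nonneg (adjInd_nonneg G a z)]
    _ = |1 - rdeg G a / x| + (1 / x + ∑ z ∈ rest a b, |adjInd G a z / x - r z|) := by
        rw [Finset.sum_add_distrib, ← Finset.sum_mul, sum_adjInd]
        congr 1
        · rw [← abs_of_pos hd, ← abs_mul, abs_of_pos hd]
          congr 1
          field_simp
        · rw [sum_eq_add_rest h.ne, hr a, hr b]
          simp [mem_rest, adjInd_of_adj h, hx.le]
    _ = rowDefect G a b x ρ := by
        rw [rowDefect, add_assoc, Finset.sum_div]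
        congr 2
        refine Finset.sum_congr rfl fun z hz ↦ ?_
        rw [hr z, if_pos hz, ← sub_div, abs_div, abs_of_pos hx, ← mul_one_sub, abs_mul,
          abs_of_nonneg (adjInd_nonneg G a z)]

/-- If a plan has row and column sums of the form `ρ / x`, it transports almost everything. -/
theorem transportDist_le_of_rowDefect (h : G.Adj a b) {x : ℝ} (hx : 0 < x) {T : V → V → ℝ}
    (hT : ∀ z w, 0 ≤ T z w) {ρ τ : V → ℝ}
    (hρ : ∀ z, ∑ w, T z w = if z ∈ rest a b then adjInd G a z * ρ z / x else 0)
    (hτ : ∀ w, ∑ z, T z w = if w ∈ rest b a then adjInd G b w * τ w / x else 0)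
    {k : ℝ} (hk : 0 ≤ k) {u : V → ℝ}
    (hd : ∀ z w, T z w * G.dist z w ≤ k * T z w - if z = w then u z else 0) :
    transportDist G (walkMeasure G a) (walkMeasure G b) ≤
      k - ∑ z, u z + (k + 3) * (rowDefect G a b x ρ + rowDefect G b a x τ) := by
  have h₁ := sum_abs_walkMeasure_sub_le h hx hρ
  have h₂ := sum_abs_walkMeasure_sub_le h.symm hx hτ
  have main := transportDist_le_of_plan (walkMeasure_nonneg G a) (walkMeasure_nonneg G b)
    (sum_walkMeasure h) (sum_walkMeasure h.symm) (G := G) (D := 3) (fun z w hz hw ↦ by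
      exact_mod_cast dist_le_three h (adj_of_walkMeasure_ne_zero hz)
        (adj_of_walkMeasure_ne_zero hw)) hT
  -- The plan may carry more than unit mass. The excess costs at most `k` per unit, which with the
  -- repair cost 3 makes the factor `k + 3`.
  have hmass : ∑ z, ∑ w, T z w ≤ 1 + rowDefect G a b x ρ := by
    have : ∑ z, (∑ w, T z w - walkMeasure G a z) ≤ ∑ z, |walkMeasure G a z - ∑ w, T z w| :=
      Finset.sum_le_sum fun z _ ↦ by
        rw [abs_sub_comm]
        exact le_abs_self _
    rw [Finset.sum_sub_distrib, sum_walkMeasure h] at this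
    linarith
  have hcost : ∑ z, ∑ w, T z w * (G.dist z w : ℝ) ≤ k * ∑ z, ∑ w, T z w - ∑ z, u z := by
    calc _ ≤ ∑ z, ∑ w, (k * T z w - if z = w then u z else 0) :=
          Finset.sum_le_sum fun z _ ↦ Finset.sum_le_sum fun w _ ↦ hd z w
      _ = _ := by simp [Finset.sum_sub_distrib, Finset.mul_sum]
  have h0 : 0 ≤ rowDefect G b a x τ :=
    (Finset.sum_nonneg fun z _ ↦ abs_nonneg _).trans h₂
  have := mul_le_mul_of_nonneg_left hmass hk
  have := mul_nonneg hk h0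
  linarith

/-- Mass moves along the paths of length two between the neighbours of `a` and those of `b`. -/
noncomputable def pathPlan (G : SimpleGraph V) (a b : V) (x M : ℝ) (z w : V) : ℝ :=
  if z ∈ rest a b ∧ w ∈ rest a b ∧ z ≠ w then
    (∑ c ∈ ((rest a b).erase z).erase w,
      adjInd G a z * (adjInd G z c * (adjInd G c w * adjInd G b w))) / (x * M) else 0

/-- Exchanging `a` and `b` transposes the plan, so column sums follow from row sums. -/
theorem pathPlan_swap (G : SimpleGraph V) (a b : V) (x M : ℝ) (z w : V) :
    pathPlan G b a x M w z = pathPlan G a b x M z w := by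
  unfold pathPlan
  rw [rest_symm b a, Finset.erase_right_comm]
  refine if_congr (by tauto) ?_ rfl
  congr 1
  refine Finset.sum_congr rfl fun c _ ↦ ?_
  rw [adjInd_symm G w c, adjInd_symm G c z]
  ring

/-- Summing over the last vertex `w`, a neighbour of `b`, turns paths `z, c, w` into paths of length
three from `z` to `b`. -/
theorem sum_pathPlan (G : SimpleGraph V) (a b : V) (x M : ℝ) (z : V) :
    ∑ w, pathPlan G a b x M z w =
      if z ∈ rest a b then adjInd G a z * (paths₃ G a b z / M) / x else 0 := by
  unfold pathPlan
  split_ifs with hz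
  · have e : adjInd G a z * (paths₃ G a b z / M) / x =
        (∑ q ∈ ((rest a b).erase z).offDiag, adjInd G a z *
          (adjInd G z q.1 * (adjInd G q.1 q.2 * adjInd G b q.2))) / (x * M) := by
      rw [← Finset.mul_sum, paths₃]
      simp_rw [edgeMonomial_insert, edgeMonomial_singleton]
      ring
    have e₁ (S : Finset V) : S.offDiag = (S ×ˢ S).filter fun q ↦ q.1 ≠ q.2 := by
      ext q; simp [Finset.mem_offDiag, and_assoc]
    rw [e, e₁, Finset.sum_filter, Finset.sum_product_right]
    simp only [hz, true_and]
    have e₂ (f : V → ℝ) : ∑ w, (if w ∈ rest a b ∧ z ≠ w then f w else 0) =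
        ∑ w ∈ (rest a b).erase z, f w := by
      rw [← Finset.sum_filter]
      congr 1
      ext w; simp [and_comm, ne_comm]
    rw [e₂, ← Finset.sum_div]
    congr 1
    refine Finset.sum_congr rfl fun w _ ↦ ?_
    rw [← Finset.sum_filter]
    congr 1
    ext c; simp [and_comm]
  · simp [hz]

/-- Every pair charged by `pathPlan` is joined by a path of length two. -/
theorem transportDist_le_two_add (h : G.Adj a b) {x M : ℝ} (hx : 0 < x) (hM : 0 < M) :
    transportDist G (walkMeasure G a) (walkMeasure G b) ≤
      2 + 5 * (rowDefect G a b x (fun z ↦ paths₃ G a b z / M) +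
        rowDefect G b a x (fun w ↦ paths₃ G b a w / M)) := by
  have hterm (z w c : V) :
      0 ≤ adjInd G a z * (adjInd G z c * (adjInd G c w * adjInd G b w)) := by
    have := adjInd_nonneg G
    exact mul_nonneg (this _ _) (mul_nonneg (this _ _) (mul_nonneg (this _ _) (this _ _)))
  have hT z w : 0 ≤ pathPlan G a b x M z w := by
    unfold pathPlan
    split_ifs
    · exact div_nonneg (Finset.sum_nonneg fun c _ ↦ hterm z w c) (by positivity)
    · exact le_rfl
  have main := transportDist_le_of_rowDefect h hx hT (sum_pathPlan G a b x M)
    (τ := fun w ↦ paths₃ G b a w / M) (fun w ↦ by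
      simp_rw [← pathPlan_swap G a b x M]
      exact sum_pathPlan G b a x M w) zero_le_two (u := fun _ ↦ 0) (fun z w ↦ by
        rw [ite_self, sub_zero, mul_comm]
        by_cases hzw : pathPlan G a b x M z w = 0
        · simp [hzw]
        refine mul_le_mul_of_nonneg_right ?_ (hT z w)
        unfold pathPlan at hzw
        split_ifs at hzw with hR
        · have : ∑ c ∈ ((rest a b).erase z).erase w,
              adjInd G a z * (adjInd G z c * (adjInd G c w * adjInd G b w)) ≠ 0 := by
            intro h0
            exact hzw (by rw [h0, zero_div])
          obtain ⟨c, -, hc⟩ := Finset.exists_ne_zero_of_sum_ne_zero this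
          have h₁ : adjInd G z c ≠ 0 := by rintro h0; simp [h0] at hc
          have h₂ : adjInd G c w ≠ 0 := by rintro h0; simp [h0] at hc
          exact_mod_cast dist_le_two_of_adj (adj_of_adjInd_ne_zero h₁) (adj_of_adjInd_ne_zero h₂)
        · exact (hzw rfl).elim)
  refine main.trans (le_of_eq ?_)
  norm_num

/-- Number of paths of length two from `z` to `b` through a neighbour of `a`. -/
noncomputable def triPaths₂ (G : SimpleGraph V) (a b z : V) : ℝ :=
  ∑ w ∈ (rest a b).erase z, edgeMonomial {s(z, w), s(b, w), s(a, w)} G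

/-- Mass at common neighbours of `a` and `b` stays, other mass moves along edges between
the remaining neighbours of `a` and those of `b`. -/
noncomputable def edgePlan (G : SimpleGraph V) (a b : V) (x M : ℝ) (z w : V) : ℝ :=
  if z ∈ rest a b ∧ w ∈ rest a b then
    if z = w then adjInd G a z * adjInd G b z / x
    else adjInd G a z * (1 - adjInd G b z) *
      (adjInd G z w * (adjInd G b w * (1 - adjInd G a w))) / (x * M)
  else 0

theorem edgePlan_swap (G : SimpleGraph V) (a b : V) (x M : ℝ) (z w : V) :
    edgePlan G b a x M w z = edgePlan G a b x M z w := by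
  unfold edgePlan
  rw [rest_symm b a, adjInd_symm G w z]
  refine if_congr and_comm ?_ rfl
  by_cases h : z = w
  · subst h
    simp [mul_comm]
  · rw [if_neg h, if_neg (Ne.symm h)]
    ring

/-- The row sums of `edgePlan`, up to normalization. -/
noncomputable def edgeRow (G : SimpleGraph V) (a b : V) (M : ℝ) (z : V) : ℝ :=
  adjInd G b z + (1 - adjInd G b z) * ((paths₂ G a b z - triPaths₂ G a b z) / M)

theorem sum_edgePlan (G : SimpleGraph V) (a b : V) (x M : ℝ) (z : V) :
    ∑ w, edgePlan G a b x M z w =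
      if z ∈ rest a b then adjInd G a z * edgeRow G a b M z / x else 0 := by
  unfold edgePlan
  split_ifs with hz
  · have e : paths₂ G a b z - triPaths₂ G a b z =
        ∑ w ∈ (rest a b).erase z, adjInd G z w * (adjInd G b w * (1 - adjInd G a w)) := by
      rw [paths₂, triPaths₂, ← Finset.sum_sub_distrib]
      refine Finset.sum_congr rfl fun w _ ↦ ?_
      simp_rw [edgeMonomial_insert, edgeMonomial_singleton]
      ring
    rw [edgeRow, e]
    simp only [hz, true_and, Finset.sum_ite_mem, Finset.univ_inter]
    rw [← Finset.add_sum_erase _ _ hz, if_pos rfl]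
    have e₂ : ∑ w ∈ (rest a b).erase z, (if z = w then adjInd G a z * adjInd G b z / x
        else adjInd G a z * (1 - adjInd G b z) *
          (adjInd G z w * (adjInd G b w * (1 - adjInd G a w))) / (x * M)) =
        ∑ w ∈ (rest a b).erase z, adjInd G a z * (1 - adjInd G b z) / (x * M) *
          (adjInd G z w * (adjInd G b w * (1 - adjInd G a w))) := by
      refine Finset.sum_congr rfl fun w hw ↦ ?_
      rw [if_neg (Finset.ne_of_mem_erase hw).symm]
      ring
    rw [e₂, ← Finset.mul_sum]
    ring
  · simp [hz]

/-- At a common neighbour the row sum is exactly right. Dropping the factor `1 - adjInd G b z`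
leaves only counts of edges other than those joining `z` to `a` and `b`. -/
theorem abs_one_sub_edgeRow_le (G : SimpleGraph V) (a b : V) (M : ℝ) (z : V) :
    |1 - edgeRow G a b M z| ≤ |1 - (paths₂ G a b z - triPaths₂ G a b z) / M| := by
  have : 1 - edgeRow G a b M z =
      (1 - adjInd G b z) * (1 - (paths₂ G a b z - triPaths₂ G a b z) / M) := by
    rw [edgeRow]; ring
  have h₀ := adjInd_nonneg G b z
  have h₁ := adjInd_le_one G b z
  rw [this, abs_mul]
  refine mul_le_of_le_one_left (abs_nonneg _) ?_
  rw [abs_of_nonneg] <;> linarith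

/-- The diagonal of `edgePlan` costs nothing and carries mass `triCount G a b / x`; every other
charged pair is an edge. -/
theorem transportDist_le_one_add (h : G.Adj a b) {x M : ℝ} (hx : 0 < x) (hM : 0 < M) :
    transportDist G (walkMeasure G a) (walkMeasure G b) ≤
      1 - triCount G a b / x +
      4 * (rowDefect G a b x (fun z ↦ (paths₂ G a b z - triPaths₂ G a b z) / M) +
        rowDefect G b a x (fun w ↦ (paths₂ G b a w - triPaths₂ G b a w) / M)) := by
  have hsub u v : 0 ≤ 1 - adjInd G u v := sub_nonneg.2 (adjInd_le_one G u v)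
  have hnn u v : 0 ≤ adjInd G u v := adjInd_nonneg G u v
  have hT z w : 0 ≤ edgePlan G a b x M z w := by
    unfold edgePlan
    have h1 := hsub a w
    have h2 := hsub b z
    have h3 := hnn a z
    have h4 := hnn z w
    have h5 := hnn b w
    have h6 := hnn b z
    split_ifs <;> positivity
  have main := transportDist_le_of_rowDefect h hx hT (sum_edgePlan G a b x M)
    (τ := edgeRow G b a M) (fun w ↦ by
      simp_rw [← edgePlan_swap G a b x M]
      exact sum_edgePlan G b a x M w) zero_le_one
    (u := fun z ↦ if z ∈ rest a b then adjInd G a z * adjInd G b z / x else 0) (fun z w ↦ by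
        rw [one_mul]
        by_cases hzw : z = w
        · subst hzw
          simp [edgePlan]
        rw [if_neg hzw, sub_zero]
        by_cases h0 : edgePlan G a b x M z w = 0
        · simp [h0]
        refine mul_le_of_le_one_right (hT z w) ?_
        have h₁ : adjInd G z w ≠ 0 := by
          intro h1
          exact h0 (by simp [edgePlan, hzw, h1])
        rw [SimpleGraph.dist_eq_one_iff_adj.2 (adj_of_adjInd_ne_zero h₁), Nat.cast_one])
  have e : ∑ z, (if z ∈ rest a b then adjInd G a z * adjInd G b z / x else 0) =
      triCount G a b / x := by
    simp [triCount, Finset.sum_div]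
  rw [e] at main
  have h₁ := rowDefect_mono (G := G) (a := a) (b := b) hx (abs_one_sub_edgeRow_le G a b M)
  have h₂ := rowDefect_mono (G := G) (a := b) (b := a) hx (abs_one_sub_edgeRow_le G b a M)
  linarith

end Plans

/-! ### Curvature estimates with the random degrees replaced by a fixed `x` -/

section Estimates

variable {V : Type*} [Fintype V] [DecidableEq V] {G : SimpleGraph V} {a b : V}

theorem triCount_le_rdeg (h : G.Adj a b) : triCount G a b ≤ rdeg G a := by
  rw [rdeg_eq h, triCount]
  have : ∑ z ∈ rest a b, adjInd G a z * adjInd G b z ≤ ∑ z ∈ rest a b, adjInd G a z :=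
    Finset.sum_le_sum fun z _ ↦ mul_le_of_le_one_right (adjInd_nonneg _ _ _) (adjInd_le_one _ _ _)
  linarith

theorem div_rdeg_le (h : G.Adj a b) {x y : ℝ} (hx : 0 < x) (h₀ : 0 ≤ y) (hy : y ≤ rdeg G a) :
    y / rdeg G a ≤ y / x + |1 - rdeg G a / x| := by
  have hd : 0 < rdeg G a := zero_lt_one.trans_le (one_le_rdeg h)
  have e : y / rdeg G a - y / x = y / rdeg G a * (1 - rdeg G a / x) := by
    field_simp
  have h1 : y / rdeg G a * (1 - rdeg G a / x) ≤ |1 - rdeg G a / x| := by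
    refine (le_abs_self _).trans ?_
    rw [abs_mul]
    refine mul_le_of_le_one_left (abs_nonneg _) ?_
    rw [abs_of_nonneg (div_nonneg h₀ hd.le)]
    exact (div_le_one hd).2 hy
  linarith

/-- The total deviation of the degrees of `a` and `b` from `x`, relative to `x`. -/
noncomputable def degError (G : SimpleGraph V) (a b : V) (x : ℝ) : ℝ :=
  |1 - rdeg G a / x| + |1 - rdeg G b / x|

theorem abs_ricci_sub_triCount_le (h : G.Adj a b) {x M : ℝ} (hx : 0 < x) (hM : 0 < M) :
    |ricci G a b - triCount G a b / x| ≤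
      5 * (rowDefect G a b x (fun z ↦ (paths₂ G a b z - triPaths₂ G a b z) / M) +
        rowDefect G b a x (fun w ↦ (paths₂ G b a w - triPaths₂ G b a w) / M)) := by
  have u := transportDist_le_one_add h hx hM
  have l := one_sub_triCount_le h
  have l' := div_rdeg_le h (x := x) hx (triCount_nonneg G a b) (triCount_le_rdeg h)
  have d₁ := abs_one_sub_le_rowDefect G a b hx
    (fun z ↦ (paths₂ G a b z - triPaths₂ G a b z) / M)
  have d₂ := (abs_nonneg _).trans (abs_one_sub_le_rowDefect G b a hx
    (fun z ↦ (paths₂ G b a z - triPaths₂ G b a z) / M))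
  have d₀ := abs_nonneg (1 - rdeg G a / x)
  rw [ricci_eq h, abs_le]
  constructor <;> linarith

/-- Here `y` need not be bounded by the degree, so `div_rdeg_le` does not apply to it. If the degree
is at least `x / 2`, then `y / rdeg G a ≤ 2 * y / x`. Otherwise `degError` is at least `1 / 2` and
the right side exceeds `k`, which suffices as `0 ≤ W`. -/
theorem sub_le_of_le_transportDist (h : G.Adj a b) {x k y W : ℝ} (hx : 0 < x) (hk : 1 ≤ k)
    (hy : 0 ≤ y) (hW : 0 ≤ W)
    (hle : k - (k - 1) / rdeg G a - (k - 1) / rdeg G b - y / rdeg G a ≤ W) :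
    k - W ≤ 2 * y / x + 2 * k / x + 3 * k * degError G a b x := by
  have ha := one_le_rdeg h
  have hb := one_le_rdeg h.symm
  have e₁ := div_rdeg_le h (x := x) hx zero_le_one ha
  have e₂ := div_rdeg_le h.symm (x := x) hx zero_le_one hb
  have n₁ := abs_nonneg (1 - rdeg G a / x)
  have n₂ := abs_nonneg (1 - rdeg G b / x)
  have n₃ : 0 ≤ y / x := by positivity
  have n₄ : 0 < 1 / x := by positivity
  have f₁ : (k - 1) / rdeg G a ≤ k * (1 / x + |1 - rdeg G a / x|) := by
    rw [div_eq_mul_one_div]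
    gcongr
    linarith
  have f₂ : (k - 1) / rdeg G b ≤ k * (1 / x + |1 - rdeg G b / x|) := by
    rw [div_eq_mul_one_div]
    gcongr
    linarith
  have p₁ := mul_nonneg (zero_le_one.trans hk) n₁
  have p₂ := mul_nonneg (zero_le_one.trans hk) n₂
  have r₁ : 2 * y / x = 2 * (y / x) := by ring
  have r₂ : 2 * k / x = 2 * (k * (1 / x)) := by ring
  rw [r₁, r₂, degError]
  rcases le_total (x / 2) (rdeg G a) with hd | hd
  · have : y / rdeg G a ≤ 2 * (y / x) := by
      rw [div_le_iff₀ (by linarith)]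
      have : 2 * (y / x) * (x / 2) ≤ 2 * (y / x) * rdeg G a := by gcongr
      have e : 2 * (y / x) * (x / 2) = y := by field_simp
      linarith
    linarith
  · have hr : rdeg G a / x ≤ 1 / 2 := by
      rw [div_le_iff₀ hx]; linarith
    have h1 : 1 / 2 ≤ |1 - rdeg G a / x| := by
      refine le_trans ?_ (le_abs_self _)
      linarith
    have h2 : k * (1 / 2) ≤ k * |1 - rdeg G a / x| := by gcongr
    have h3 : 0 < k * (1 / x) := by positivity
    linarith

theorem abs_ricci_add_one_le (h : G.Adj a b) {x M : ℝ} (hx : 0 < x) (hM : 0 < M) :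
    |ricci G a b - -1| ≤ 4 * (triCount G a b + quadCount G a b) / x +
      11 * (rowDefect G a b x (fun z ↦ paths₃ G a b z / M) +
        rowDefect G b a x (fun w ↦ paths₃ G b a w / M)) := by
  have u := transportDist_le_two_add h hx hM
  have n₁ := triCount_nonneg G a b
  have n₂ := quadCount_nonneg G a b
  have l := sub_le_of_le_transportDist h (y := 2 * (triCount G a b + quadCount G a b)) hx
    one_le_two (by positivity) (transportDist_nonneg G _ _)
    (by norm_num; simpa using two_sub_quadCount_le h)
  have d₁ := abs_one_sub_add_le_rowDefect G a b hx (fun z ↦ paths₃ G a b z / M)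
  have d₂ := abs_one_sub_add_le_rowDefect G b a hx (fun z ↦ paths₃ G b a z / M)
  have n₃ := abs_nonneg (1 - rdeg G a / x)
  have n₄ := abs_nonneg (1 - rdeg G b / x)
  have n₅ : 0 < 1 / x := by positivity
  have n₆ : 0 ≤ 4 * (triCount G a b + quadCount G a b) / x := by positivity
  have r₁ : 2 * (2 * (triCount G a b + quadCount G a b)) / x =
    4 * (triCount G a b + quadCount G a b) / x := by ring
  have r₂ : 2 * 2 / x = 4 * (1 / x) := by ring
  rw [r₁, r₂, degError] at l
  rw [ricci_eq h, abs_le]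
  constructor <;> linarith

/-- The quantity to bound is `3 - W₁`, which lies between 0 and 3. A single triangle makes `3 *
triCount` at least 3; without triangles the 5-cycle bound applies. -/
theorem abs_ricci_add_two_le (h : G.Adj a b) {x : ℝ} (hx : 0 < x) :
    |ricci G a b - -2| ≤ 3 * triCount G a b + 6 * (quadCount G a b + pentCount G a b) / x + 6 / x +
      9 * degError G a b x := by
  have u := transportDist_walkMeasure_le_three h
  have n₁ := triCount_nonneg G a b
  have n₂ := quadCount_nonneg G a b
  have n₃ := pentCount_nonneg G a b
  have n₄ : 0 ≤ degError G a b x := add_nonneg (abs_nonneg _) (abs_nonneg _)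
  have n₅ : 0 ≤ 6 * (quadCount G a b + pentCount G a b) / x := by positivity
  have n₆ : 0 ≤ 6 / x := by positivity
  rw [ricci_eq h, abs_of_nonneg (by linarith)]
  by_cases h₀ : triCount G a b = 0
  · have l := sub_le_of_le_transportDist h (y := 3 * (quadCount G a b + pentCount G a b)) hx
      (by norm_num : (1 : ℝ) ≤ 3) (by positivity) (transportDist_nonneg G _ _)
      (by norm_num; simpa using three_sub_pentCount_le h h₀)
    have r₁ : 2 * (3 * (quadCount G a b + pentCount G a b)) / x =
      6 * (quadCount G a b + pentCount G a b) / x := by ring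
    have r₂ : 2 * 3 / x = 6 / x := by ring
    rw [r₁, r₂] at l
    linarith
  · have : 1 ≤ triCount G a b := by
      obtain ⟨z, hz, hne⟩ := Finset.exists_ne_zero_of_sum_ne_zero h₀
      have h1 : adjInd G a z ≠ 0 := by rintro h0; simp [h0] at hne
      have h2 : adjInd G b z ≠ 0 := by rintro h0; simp [h0] at hne
      refine le_trans (le_of_eq ?_) (Finset.single_le_sum
        (f := fun z ↦ adjInd G a z * adjInd G b z)
        (fun z _ ↦ mul_nonneg (adjInd_nonneg _ _ _) (adjInd_nonneg _ _ _)) hz)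
      simp [adjInd_of_adj (adj_of_adjInd_ne_zero h1), adjInd_of_adj (adj_of_adjInd_ne_zero h2)]
    have := transportDist_nonneg G (walkMeasure G a) (walkMeasure G b)
    linarith

end Estimates

/-! ### First moments of cycle counts and concentration of path counts -/

section Moments

variable {V : Type*} {a b : V}

theorem isFree_insert [DecidableEq V] {u v : V} {S : Finset (Sym2 V)} :
    IsFree a b (insert s(u, v) S) ↔ (u ≠ v ∧ s(u, v) ≠ s(a, b)) ∧ IsFree a b S := by
  simp [IsFree]

theorem isFree_singleton {u v : V} :
    IsFree a b {s(u, v)} ↔ u ≠ v ∧ s(u, v) ≠ s(a, b) := by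
  simp [IsFree]

/-- Two common edges would determine both inner vertices. Hence two distinct paths together use at
least five edges. -/
theorem inter_card_le_one_of_paths₃ [DecidableEq V] {z b c w c' w' : V} (hzb : z ≠ b) (hzc : z ≠ c)
    (hzw : z ≠ w) (hbc : b ≠ c) (hbw : b ≠ w) (hcw : c ≠ w) (hzc' : z ≠ c') (hzw' : z ≠ w')
    (hbc' : b ≠ c') (hbw' : b ≠ w') (hcw' : c' ≠ w') (hne : ¬ (c = c' ∧ w = w')) :
    (({s(z, c), s(c, w), s(b, w)} : Finset (Sym2 V)) ∩ {s(z, c'), s(c', w'), s(b, w')}).card ≤ 1 := by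
  rw [Finset.card_le_one]
  intro e he f hf
  simp only [Finset.mem_inter, Finset.mem_insert, Finset.mem_singleton] at he hf
  obtain ⟨he, he'⟩ := he
  obtain ⟨hf, hf'⟩ := hf
  rcases he with rfl | rfl | rfl <;> rcases hf with rfl | rfl | rfl <;>
    simp only [Sym2.eq_iff] at he' hf' ⊢ <;> grind

theorem not_disjoint_paths₃ [DecidableEq V] {z b c w c' w' : V} (hzb : z ≠ b) (hzc : z ≠ c)
    (hzw : z ≠ w) (hbc : b ≠ c) (hbw : b ≠ w) (hzc' : z ≠ c') (hzw' : z ≠ w')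
    (hbc' : b ≠ c') (hbw' : b ≠ w')
    (h : ¬ Disjoint ({s(z, c), s(c, w), s(b, w)} : Finset (Sym2 V)) {s(z, c'), s(c', w'), s(b, w')}) :
    c' = c ∨ w' = w ∨ (c' = w ∧ w' = c) := by
  rw [Finset.not_disjoint_iff] at h
  obtain ⟨e, he, he'⟩ := h
  simp only [Finset.mem_insert, Finset.mem_singleton] at he he'
  rcases he with rfl | rfl | rfl <;> simp only [Sym2.eq_iff] at he' <;> grind

theorem card_paths₃ [DecidableEq V] {z b c w : V} (hzw : z ≠ w) (hbc : b ≠ c) (hcw : c ≠ w) :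
    ({s(z, c), s(c, w), s(b, w)} : Finset (Sym2 V)).card = 3 := by
  rw [Finset.card_eq_three]
  refine ⟨_, _, _, ?_, ?_, ?_, rfl⟩ <;> rw [Ne, Sym2.eq_iff] <;> grind

theorem card_paths₂ [DecidableEq V] {z b w : V} (hzb : z ≠ b) (hzw : z ≠ w) :
    ({s(z, w), s(b, w)} : Finset (Sym2 V)).card = 2 := by
  rw [Finset.card_pair]
  rw [Ne, Sym2.eq_iff]
  grind

variable [Fintype V] [DecidableEq V]

theorem isFree_paths₃ {z c w : V} (hz : z ∈ rest a b) (hc : c ∈ (rest a b).erase z)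
    (hw : w ∈ (rest a b).erase z) (hcw : c ≠ w) :
    IsFree a b {s(z, c), s(c, w), s(b, w)} := by
  simp only [isFree_insert, isFree_singleton, Ne, Sym2.eq_iff, Finset.mem_erase, mem_rest] at *
  grind

theorem isFree_paths₂ {z w : V} (hz : z ∈ rest a b) (hw : w ∈ (rest a b).erase z) :
    IsFree a b {s(z, w), s(b, w)} := by
  simp only [isFree_insert, isFree_singleton, Ne, Sym2.eq_iff, Finset.mem_erase, mem_rest] at *
  grind

theorem isFree_adj {z : V} (hz : z ∈ rest a b) : IsFree a b {s(a, z)} := by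
  simp only [isFree_singleton, Ne, Sym2.eq_iff, mem_rest] at *
  grind

theorem isFree_adj' {z : V} (hz : z ∈ rest a b) : IsFree a b {s(b, z)} := by
  simp only [isFree_singleton, Ne, Sym2.eq_iff, mem_rest] at *
  grind

namespace IsEdgeLaw

variable {P : Measure (SimpleGraph V)} {p : ℝ}

theorem card_rest_le (_ : IsEdgeLaw P p a b) : ((rest a b).card : ℝ) ≤ Fintype.card V := by
  exact_mod_cast Finset.card_le_univ _

theorem two_le_card (h : IsEdgeLaw P p a b) : 2 ≤ Fintype.card V := by
  rw [← Finset.card_pair h.ne]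
  exact Finset.card_le_univ _

theorem cast_card_rest (h : IsEdgeLaw P p a b) :
    ((rest a b).card : ℝ) = Fintype.card V - 2 := by
  rw [card_rest h.ne, Nat.cast_sub h.two_le_card]
  norm_num

theorem card_erase (h : IsEdgeLaw P p a b) {z : V} (hz : z ∈ rest a b) :
    (((rest a b).erase z).card : ℝ) = Fintype.card V - 3 := by
  have h1 := Finset.card_erase_add_one hz
  have h2 := h.cast_card_rest
  rw [← h1] at h2
  push_cast at h2
  linarith

/-- A path overlaps with itself, giving `p ^ 3`, and with at most `3 * N` others (same first inner
vertex, same second one, or the two exchanged), each giving at most `p ^ 5`. There are at most `N ^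
2` paths. -/
theorem sum_paths₃_overlap_le (h : IsEdgeLaw P p a b) {z : V} (hz : z ∈ rest a b) :
    ∑ i ∈ ((rest a b).erase z).offDiag, ∑ j ∈ ((rest a b).erase z).offDiag,
      (if Disjoint ({s(z, i.1), s(i.1, i.2), s(b, i.2)} : Finset (Sym2 V))
        {s(z, j.1), s(j.1, j.2), s(b, j.2)} then 0 else
        p ^ (({s(z, i.1), s(i.1, i.2), s(b, i.2)} : Finset (Sym2 V)) ∪
        {s(z, j.1), s(j.1, j.2), s(b, j.2)}).card) ≤
      (Fintype.card V) ^ 2 * (p ^ 3 + 3 * Fintype.card V * p ^ 5) := by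
  have hp := h.pos
  set K := (rest a b).erase z with hK
  have hKN : (K.card : ℝ) ≤ Fintype.card V := by exact_mod_cast Finset.card_le_univ _
  have hmem {u : V} (hu : u ∈ K) : z ≠ u ∧ b ≠ u := by
    rw [hK, Finset.mem_erase, mem_rest] at hu
    exact ⟨hu.1.symm, hu.2.2.symm⟩
  have hzb := (mem_rest.1 hz).2
  have hOK : (K.offDiag.card : ℝ) ≤ (Fintype.card V) ^ 2 := by
    norm_cast
    refine (Finset.card_le_univ _).trans (le_of_eq ?_)
    rw [Fintype.card_prod, sq]
  refine (Finset.sum_le_card_nsmul _ _ (p ^ 3 + 3 * Fintype.card V * p ^ 5)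
    fun i hi ↦ ?_).trans ?_
  · obtain ⟨hc, hw, hcw⟩ := Finset.mem_offDiag.1 hi
    calc _ ≤ ∑ j ∈ K.offDiag, ((if j = i then p ^ 3 else 0) + ((if j.1 = i.1 then p ^ 5 else 0) +
          (if j.2 = i.2 then p ^ 5 else 0) + if j = (i.2, i.1) then p ^ 5 else 0)) := by
          refine Finset.sum_le_sum fun j hj ↦ ?_
          obtain ⟨hc', hw', hcw'⟩ := Finset.mem_offDiag.1 hj
          have n₁ : 0 ≤ if j = i then p ^ 3 else 0 := by positivity
          have n₂ : 0 ≤ if j.1 = i.1 then p ^ 5 else 0 := by positivity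
          have n₃ : 0 ≤ if j.2 = i.2 then p ^ 5 else 0 := by positivity
          have n₄ : 0 ≤ if j = (i.2, i.1) then p ^ 5 else 0 := by positivity
          rcases em (Disjoint ({s(z, i.1), s(i.1, i.2), s(b, i.2)} : Finset (Sym2 V))
            {s(z, j.1), s(j.1, j.2), s(b, j.2)}) with hd | hd
          · rw [if_pos hd]
            linarith
          rw [if_neg hd]
          by_cases hij : j = i
          · subst hij
            rw [Finset.union_self, card_paths₃ (hmem hw).1 (hmem hc).2 hcw]
            rw [if_pos rfl]
            linarith
          have h5 : 5 ≤ (({s(z, i.1), s(i.1, i.2), s(b, i.2)} : Finset (Sym2 V)) ∪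
              {s(z, j.1), s(j.1, j.2), s(b, j.2)}).card := by
            have h1 := inter_card_le_one_of_paths₃ hzb (hmem hc).1 (hmem hw).1 (hmem hc).2
              (hmem hw).2 hcw (hmem hc').1 (hmem hw').1 (hmem hc').2 (hmem hw').2 hcw'
              (fun h ↦ hij (Prod.ext h.1.symm h.2.symm))
            have h2 := Finset.card_union_add_card_inter
              ({s(z, i.1), s(i.1, i.2), s(b, i.2)} : Finset (Sym2 V))
              {s(z, j.1), s(j.1, j.2), s(b, j.2)}
            rw [card_paths₃ (hmem hw).1 (hmem hc).2 hcw,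
              card_paths₃ (hmem hw').1 (hmem hc').2 hcw'] at h2
            omega
          have hle := pow_le_pow_of_le_one hp.le h.le_one h5
          rcases not_disjoint_paths₃ hzb (hmem hc).1 (hmem hw).1 (hmem hc).2 (hmem hw).2
            (hmem hc').1 (hmem hw').1 (hmem hc').2 (hmem hw').2 hd with h' | h' | h'
          · rw [if_pos h'] at n₂ ⊢
            linarith
          · rw [if_pos h'] at n₃ ⊢
            linarith
          · have h'' : j = (i.2, i.1) := Prod.ext h'.1 h'.2
            rw [if_pos h''] at n₄ ⊢
            linarith
      _ ≤ p ^ 3 + (Fintype.card V * p ^ 5 + Fintype.card V * p ^ 5 + p ^ 5) := by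
          rw [Finset.sum_add_distrib, Finset.sum_add_distrib, Finset.sum_add_distrib]
          have hsub : K.offDiag ⊆ K ×ˢ K := fun q hq ↦ by
            obtain ⟨h1, h2, -⟩ := Finset.mem_offDiag.1 hq
            exact Finset.mem_product.2 ⟨h1, h2⟩
          have hp5 : 0 ≤ p ^ 5 := by positivity
          refine add_le_add ?_ (add_le_add (add_le_add ?_ ?_) ?_)
          · rw [Finset.sum_ite_eq', if_pos hi]
          · refine (Finset.sum_le_sum_of_subset_of_nonneg hsub fun _ _ _ ↦ by positivity).trans ?_
            rw [Finset.sum_product_right]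
            simp only [Finset.sum_ite_eq', hc, if_true, Finset.sum_const, nsmul_eq_mul]
            gcongr
          · refine (Finset.sum_le_sum_of_subset_of_nonneg hsub fun _ _ _ ↦ by positivity).trans ?_
            rw [Finset.sum_product]
            simp only [Finset.sum_ite_eq', hw, if_true, Finset.sum_const, nsmul_eq_mul]
            gcongr
          · rw [Finset.sum_ite_eq']
            split_ifs <;> [exact le_rfl; exact hp5]
      _ ≤ _ := by
          have : (1 : ℝ) ≤ Fintype.card V := by
            exact_mod_cast one_le_two.trans h.two_le_card
          have := mul_le_mul_of_nonneg_right this (by positivity : 0 ≤ p ^ 5)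
          linarith
  · rw [nsmul_eq_mul]
    gcongr

variable [IsProbabilityMeasure P]

/-- With pairwise disjoint edge sets only the diagonal of the double sum survives. -/
theorem integral_edgeMonomial_mul_abs_le_of_disjoint (h : IsEdgeLaw P p a b) {ι : Type*}
    (J : Finset ι) (S : ι → Finset (Sym2 V)) (k : ℕ) (hk : ∀ i ∈ J, (S i).card = k)
    (hS : ∀ i ∈ J, IsFree a b (S i)) {F : Finset (Sym2 V)} (hF : IsFree a b F)
    (hd : ∀ i ∈ J, Disjoint F (S i)) (hJ : ∀ i ∈ J, ∀ j ∈ J, i ≠ j → Disjoint (S i) (S j)) {v : ℝ}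
    (hv : J.card * p ^ k ≤ v) :
    ∫ G, edgeMonomial F G * |∑ i ∈ J, edgeMonomial (S i) G - J.card * p ^ k| ∂P ≤
      p ^ F.card * √v := by
  classical
  have hp := h.pos
  refine h.integral_edgeMonomial_mul_abs_le J S k hk hS hF hd (le_trans (by positivity) hv)
    (le_trans ?_ hv)
  rw [← nsmul_eq_mul]
  refine Finset.sum_le_card_nsmul _ _ _ fun i hi ↦ ?_
  calc _ ≤ ∑ j ∈ J, if i = j then p ^ k else 0 := by
        refine Finset.sum_le_sum fun j hj ↦ ?_
        by_cases hij : i = j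
        · subst hij
          rw [if_pos rfl, Finset.union_self, hk i hi]
          split_ifs
          · positivity
          · exact le_rfl
        · rw [if_pos (hJ i hi j hj hij), if_neg hij]
    _ ≤ p ^ k := by simp [hi]

theorem integral_triCount_le (h : IsEdgeLaw P p a b) :
    ∫ G, triCount G a b ∂P ≤ Fintype.card V * p ^ 2 := by
  have hp := h.pos
  unfold triCount
  rw [integral_finsetSum _ fun _ _ ↦ .of_finite]
  refine (Finset.sum_le_card_nsmul _ _ (p ^ 2) fun z hz ↦ ?_).trans ?_
  · have : (fun G : SimpleGraph V ↦ adjInd G a z * adjInd G b z) =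
        fun G ↦ edgeMonomial {s(a, z), s(b, z)} G := by
      ext G; rw [edgeMonomial_insert, edgeMonomial_singleton]
    rw [this, h.integral_edgeMonomial, card_paths₂ h.ne (mem_rest.1 hz).1.symm]
    exact isFree_insert.2 ⟨isFree_singleton.1 (isFree_adj hz), isFree_adj' hz⟩
  · rw [nsmul_eq_mul]
    have := h.card_rest_le
    gcongr

theorem integral_quadCount_le (h : IsEdgeLaw P p a b) :
    ∫ G, quadCount G a b ∂P ≤ (Fintype.card V) ^ 2 * p ^ 3 := by
  have hp := h.pos
  unfold quadCount paths₂
  rw [integral_finsetSum _ fun _ _ ↦ .of_finite]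
  refine (Finset.sum_le_card_nsmul _ _ (Fintype.card V * p ^ 3) fun z hz ↦ ?_).trans ?_
  · simp_rw [Finset.mul_sum]
    rw [integral_finsetSum _ fun _ _ ↦ .of_finite]
    refine (Finset.sum_le_card_nsmul _ _ (p ^ 3) fun w hw ↦ ?_).trans ?_
    · simp_rw [← edgeMonomial_insert]
      rw [h.integral_edgeMonomial, Finset.card_insert_of_notMem, card_paths₂]
      · exact (mem_rest.1 hz).2
      · exact (Finset.ne_of_mem_erase hw).symm
      · simp only [Finset.mem_insert, Finset.mem_singleton, Sym2.eq_iff, Finset.mem_erase,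
          mem_rest] at hz hw ⊢
        grind
      · exact isFree_insert.2 ⟨isFree_singleton.1 (isFree_adj hz), isFree_paths₂ hz hw⟩
    · rw [nsmul_eq_mul]
      have : (((rest a b).erase z).card : ℝ) ≤ Fintype.card V := by
        exact_mod_cast Finset.card_le_univ _
      gcongr
  · rw [nsmul_eq_mul, sq, mul_assoc]
    have := h.card_rest_le
    gcongr

theorem integral_pentCount_le (h : IsEdgeLaw P p a b) :
    ∫ G, pentCount G a b ∂P ≤ (Fintype.card V) ^ 3 * p ^ 4 := by
  have hp := h.pos
  unfold pentCount paths₃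
  rw [integral_finsetSum _ fun _ _ ↦ .of_finite]
  refine (Finset.sum_le_card_nsmul _ _ ((Fintype.card V) ^ 2 * p ^ 4) fun z hz ↦ ?_).trans ?_
  · simp_rw [Finset.mul_sum]
    rw [integral_finsetSum _ fun _ _ ↦ .of_finite]
    refine (Finset.sum_le_card_nsmul _ _ (p ^ 4) fun q hq ↦ ?_).trans ?_
    · obtain ⟨hc, hw, hcw⟩ := Finset.mem_offDiag.1 hq
      simp_rw [← edgeMonomial_insert]
      rw [h.integral_edgeMonomial, Finset.card_insert_of_notMem, card_paths₃]
      · exact (Finset.ne_of_mem_erase hw).symm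
      · exact (mem_rest.1 (Finset.mem_of_mem_erase hc)).2.symm
      · exact hcw
      · simp only [Finset.mem_insert, Finset.mem_singleton, Sym2.eq_iff, Finset.mem_erase,
          mem_rest] at hz hw hc ⊢
        grind
      · exact isFree_insert.2 ⟨isFree_singleton.1 (isFree_adj hz), isFree_paths₃ hz hc hw hcw⟩
    · rw [nsmul_eq_mul]
      have : ((((rest a b).erase z).offDiag).card : ℝ) ≤ (Fintype.card V) ^ 2 := by
        norm_cast
        refine (Finset.card_le_univ _).trans (le_of_eq ?_)
        rw [Fintype.card_prod, sq]
      gcongr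
  · rw [nsmul_eq_mul, pow_succ' _ 2, mul_assoc]
    have := h.card_rest_le
    gcongr

theorem integral_abs_one_sub_rdeg_le (h : IsEdgeLaw P p a b) :
    ∫ G, |1 - rdeg G a / (Fintype.card V * p)| ∂P ≤
      1 / (Fintype.card V * p) + 1 / √(Fintype.card V * p) := by
  have hp := h.pos
  have hN : (0 : ℝ) < Fintype.card V := by exact_mod_cast zero_lt_two.trans_le h.two_le_card
  set x : ℝ := Fintype.card V * p with hx
  have hx0 : 0 < x := by positivity
  have key := h.integral_edgeMonomial_mul_abs_le_of_disjoint (rest a b)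
    (fun z ↦ {s(a, z)}) 1 (fun _ _ ↦ rfl) (fun z hz ↦ isFree_adj hz) (isFree_empty a b)
    (fun _ _ ↦ Finset.disjoint_empty_left _) (fun z hz w hw hzw ↦ by
      rw [Finset.disjoint_singleton, Ne, Sym2.eq_iff]
      rw [mem_rest] at hz hw
      grind) (v := x) (by
        rw [pow_one]
        exact mul_le_mul_of_nonneg_right h.card_rest_le hp.le)
  simp only [edgeMonomial_empty, one_mul, Finset.card_empty, pow_zero, pow_one,
    edgeMonomial_singleton] at key
  calc ∫ G, |1 - rdeg G a / x| ∂P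
      ≤ ∫ G, (1 / x + 1 / x * |∑ z ∈ rest a b, adjInd G a z - (rest a b).card * p|) ∂P := by
        refine integral_mono_ae .of_finite .of_finite ?_
        filter_upwards [h.ae_adj] with G hG
        rw [rdeg_eq hG, h.cast_card_rest]
        -- The mean degree is `1 + (N - 2) * p`, so the bias relative to `x = N * p` is `(1 - 2 * p)
        -- / x`, at most `1 / x` in absolute value.
        have e : 1 - (1 + ∑ z ∈ rest a b, adjInd G a z) / x = 1 / x * (2 * p - 1) +
            1 / x * -(∑ z ∈ rest a b, adjInd G a z - (Fintype.card V - 2) * p) := by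
          field_simp
          rw [hx]
          ring
        rw [e]
        refine (abs_add_le _ _).trans ?_
        rw [abs_mul, abs_mul, abs_neg, abs_of_pos (by positivity : 0 < 1 / x)]
        gcongr
        refine mul_le_of_le_one_right (by positivity) ?_
        have := h.le_one
        rw [abs_le]; constructor <;> linarith
    _ = 1 / x + 1 / x * ∫ G, |∑ z ∈ rest a b, adjInd G a z - (rest a b).card * p| ∂P := by
        rw [integral_add .of_finite .of_finite, integral_const_mul]
        simp
    _ ≤ 1 / x + 1 / x * √x := by gcongr
    _ = _ := by
        have : √x ≠ 0 := (Real.sqrt_pos.2 hx0).ne'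
        congr 1
        rw [div_mul_eq_mul_div, one_mul, div_eq_div_iff hx0.ne' this, one_mul,
          Real.mul_self_sqrt hx0.le]

theorem integral_abs_triCount_sub_le (h : IsEdgeLaw P p a b) :
    ∫ G, |triCount G a b / (Fintype.card V * p) - p| ∂P ≤
      2 / Fintype.card V + 1 / √(Fintype.card V) := by
  have hp := h.pos
  have hN : (0 : ℝ) < Fintype.card V := by exact_mod_cast zero_lt_two.trans_le h.two_le_card
  set N : ℝ := ((Fintype.card V : ℕ) : ℝ) with hNd
  have key := h.integral_edgeMonomial_mul_abs_le_of_disjoint (rest a b)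
    (fun z ↦ {s(a, z), s(b, z)}) 2 (fun z hz ↦ card_paths₂ h.ne (mem_rest.1 hz).1.symm)
    (fun z hz ↦ isFree_insert.2 ⟨isFree_singleton.1 (isFree_adj hz), isFree_adj' hz⟩)
    (isFree_empty a b)
    (fun _ _ ↦ Finset.disjoint_empty_left _) (fun z hz w hw hzw ↦ by
      rw [Finset.disjoint_left]
      intro e he he'
      have := h.ne
      simp only [mem_rest, Finset.mem_insert, Finset.mem_singleton] at hz hw he he'
      rcases he with rfl | rfl <;> simp only [Sym2.eq_iff] at he' <;> grind) (v := N * p ^ 2) (by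
        have := h.card_rest_le
        gcongr)
  simp only [edgeMonomial_empty, one_mul, Finset.card_empty, pow_zero,
    edgeMonomial_singleton, edgeMonomial_insert] at key
  calc ∫ G, |triCount G a b / (N * p) - p| ∂P
      ≤ ∫ G, (2 / N + 1 / (N * p) * |∑ z ∈ rest a b, adjInd G a z * adjInd G b z -
          (rest a b).card * p ^ 2|) ∂P := by
        refine integral_mono .of_finite .of_finite fun G ↦ ?_
        dsimp only
        rw [triCount, h.cast_card_rest]
        have e : (∑ z ∈ rest a b, adjInd G a z * adjInd G b z) / (N * p) - p = -(2 / N * p) +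
            1 / (N * p) * (∑ z ∈ rest a b, adjInd G a z * adjInd G b z - (N - 2) * p ^ 2) := by
          field_simp
          ring
        rw [e]
        refine (abs_add_le _ _).trans ?_
        rw [abs_neg, abs_mul _ (_ - _), abs_of_pos (by positivity : 0 < 1 / (N * p)),
          abs_of_pos (by positivity : 0 < 2 / N * p)]
        gcongr
        exact mul_le_of_le_one_right (by positivity) h.le_one
    _ = 2 / N + 1 / (N * p) * ∫ G, |∑ z ∈ rest a b, adjInd G a z * adjInd G b z -
          (rest a b).card * p ^ 2| ∂P := by
        rw [integral_add .of_finite .of_finite, integral_const_mul]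
        simp
    _ ≤ 2 / N + 1 / (N * p) * √(N * p ^ 2) := by gcongr
    _ = _ := by
        have : √N ≠ 0 := (Real.sqrt_pos.2 hN).ne'
        congr 1
        rw [Real.sqrt_mul hN.le, Real.sqrt_sq hp.le]
        have e : N = √N * √N := (Real.mul_self_sqrt hN.le).symm
        nth_rewrite 1 [e]
        field_simp

/-- The factor `p` in the hypothesis on `ρ` is the probability of the edge `(a, z)`; it cancels
against the normalization `N * p` after summing over `z`. -/
theorem integral_rowDefect_le (h : IsEdgeLaw P p a b) (ρ : SimpleGraph V → V → ℝ) {ε : ℝ}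
    (hε : 0 ≤ ε) (hρ : ∀ z ∈ rest a b, ∫ G, adjInd G a z * |1 - ρ G z| ∂P ≤ p * ε) :
    ∫ G, rowDefect G a b (Fintype.card V * p) (ρ G) ∂P ≤
      2 / (Fintype.card V * p) + 1 / √(Fintype.card V * p) + ε := by
  have hp := h.pos
  have hN : (0 : ℝ) < Fintype.card V := by exact_mod_cast zero_lt_two.trans_le h.two_le_card
  have h1 := h.integral_abs_one_sub_rdeg_le
  unfold rowDefect
  set x : ℝ := Fintype.card V * p with hx
  have hx0 : 0 < x := by positivity
  rw [integral_add .of_finite .of_finite, integral_add .of_finite .of_finite, integral_div _ fun G ↦ ∑ z ∈ rest a b, _,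
    integral_finsetSum _ fun _ _ ↦ .of_finite]
  have h2 : (∑ z ∈ rest a b, ∫ G, adjInd G a z * |1 - ρ G z| ∂P) / x ≤ ε := by
    rw [div_le_iff₀ hx0]
    refine (Finset.sum_le_card_nsmul _ _ _ hρ).trans ?_
    rw [nsmul_eq_mul]
    have := h.card_rest_le
    calc _ ≤ Fintype.card V * (p * ε) := by gcongr
      _ = _ := by rw [hx]; ring
  have h3 : ∫ _ : SimpleGraph V, 1 / x ∂P = 1 / x := by simp
  have h4 : 2 / x = 1 / x + 1 / x := by ring
  linarith

/-- The normalization is the mean: there are `N - 3` midpoints, each joined to `z` and `b` but not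
to `a`. Both counts run over edge-disjoint configurations avoiding the edge `(a, z)`, and since `p ^
3 ≤ p ^ 2` the variance bound `N * p ^ 2` serves for both. -/
theorem integral_paths₂_defect_le (h : IsEdgeLaw P p a b) (hV : 6 ≤ Fintype.card V) (hp1 : p < 1)
    {z : V} (hz : z ∈ rest a b) :
    ∫ G, adjInd G a z * |1 - (paths₂ G a b z - triPaths₂ G a b z) /
      ((Fintype.card V - 3) * (p ^ 2 * (1 - p)))| ∂P ≤
      p * (4 / (√(Fintype.card V * p ^ 2) * (1 - p))) := by
  have hp := h.pos
  have hN : (6 : ℝ) ≤ Fintype.card V := by exact_mod_cast hV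
  have hcard := h.card_erase hz
  set N : ℝ := ((Fintype.card V : ℕ) : ℝ) with hNd
  have hq : 0 < 1 - p := by linarith
  have hN3 : 0 < N - 3 := by linarith
  have hab := h.ne
  have hz' := mem_rest.1 hz
  have k₁ := h.integral_edgeMonomial_mul_abs_le_of_disjoint ((rest a b).erase z)
    (fun w ↦ {s(z, w), s(b, w)}) 2
    (fun w hw ↦ card_paths₂ hz'.2 (Finset.ne_of_mem_erase hw).symm)
    (fun w hw ↦ isFree_paths₂ hz hw) (isFree_adj hz)
    (fun w hw ↦ by
      simp only [Finset.disjoint_singleton_left, Finset.mem_insert, Finset.mem_singleton,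
        Sym2.eq_iff, Finset.mem_erase, mem_rest] at hw ⊢
      grind)
    (fun w hw w' hw' hww ↦ by
      rw [Finset.disjoint_left]
      intro e he he'
      simp only [Finset.mem_erase, mem_rest, Finset.mem_insert, Finset.mem_singleton] at hw hw' he he'
      rcases he with rfl | rfl <;> simp only [Sym2.eq_iff] at he' <;> grind) (v := N * p ^ 2) (by
        rw [hcard]
        gcongr
        linarith)
  have k₂ := h.integral_edgeMonomial_mul_abs_le_of_disjoint ((rest a b).erase z)
    (fun w ↦ {s(z, w), s(b, w), s(a, w)}) 3
    (fun w hw ↦ by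
      rw [Finset.card_eq_three]
      rw [Finset.mem_erase, mem_rest] at hw
      refine ⟨_, _, _, ?_, ?_, ?_, rfl⟩ <;> rw [Ne, Sym2.eq_iff] <;> grind)
    (fun w hw ↦ by
      simp only [isFree_insert, isFree_singleton, Ne, Sym2.eq_iff, Finset.mem_erase, mem_rest] at *
      grind) (isFree_adj hz)
    (fun w hw ↦ by
      simp only [Finset.disjoint_singleton_left, Finset.mem_insert, Finset.mem_singleton,
        Sym2.eq_iff, Finset.mem_erase, mem_rest] at hw ⊢
      grind)
    (fun w hw w' hw' hww ↦ by
      rw [Finset.disjoint_left]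
      intro e he he'
      simp only [Finset.mem_erase, mem_rest, Finset.mem_insert, Finset.mem_singleton] at hw hw' he he'
      rcases he with rfl | rfl | rfl <;> simp only [Sym2.eq_iff] at he' <;> grind)
    (v := N * p ^ 2) (by
        rw [hcard]
        have : p ^ 3 ≤ p ^ 2 := pow_le_pow_of_le_one hp.le h.le_one (by norm_num)
        gcongr
        linarith)
  simp only [edgeMonomial_singleton, Finset.card_singleton, pow_one, hcard] at k₁ k₂
  set M := (N - 3) * (p ^ 2 * (1 - p)) with hM
  have hM0 : 0 < M := by positivity
  calc _ ≤ ∫ G, (1 / M * (adjInd G a z * |paths₂ G a b z - (N - 3) * p ^ 2|) +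
        1 / M * (adjInd G a z * |triPaths₂ G a b z - (N - 3) * p ^ 3|)) ∂P := by
        refine integral_mono .of_finite .of_finite fun G ↦ ?_
        dsimp only
        have e : 1 - (paths₂ G a b z - triPaths₂ G a b z) / M =
            1 / M * (triPaths₂ G a b z - (N - 3) * p ^ 3) -
            1 / M * (paths₂ G a b z - (N - 3) * p ^ 2) := by
          field_simp
          rw [hM]
          ring
        rw [e]
        have := abs_sub (1 / M * (triPaths₂ G a b z - (N - 3) * p ^ 3))
          (1 / M * (paths₂ G a b z - (N - 3) * p ^ 2))
        rw [abs_mul, abs_mul, abs_of_pos (by positivity : 0 < 1 / M)] at this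
        have := mul_le_mul_of_nonneg_left this (adjInd_nonneg G a z)
        linarith
    _ ≤ 1 / M * (p * √(N * p ^ 2)) + 1 / M * (p * √(N * p ^ 2)) := by
        rw [integral_add .of_finite .of_finite, integral_const_mul, integral_const_mul]
        gcongr
        · exact k₁
        · exact k₂
    _ ≤ p * (4 / (√(N * p ^ 2) * (1 - p))) := by
        set s := √(N * p ^ 2) with hs
        have hs0 : 0 < s := Real.sqrt_pos.2 (by positivity)
        have hss : s * s = N * p ^ 2 := Real.mul_self_sqrt (by positivity)
        -- This is `N - 3 ≥ N / 2`, where `6 ≤ N` enters.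
        have hMs : s * s * (1 - p) / 2 ≤ M := by
          rw [hss, hM]
          have : 0 < p ^ 2 * (1 - p) := by positivity
          nlinarith
        have : 1 / M ≤ 1 / (s * s * (1 - p) / 2) :=
          one_div_le_one_div_of_le (by positivity) hMs
        calc _ = 2 * (p * s) * (1 / M) := by ring
          _ ≤ 2 * (p * s) * (1 / (s * s * (1 - p) / 2)) := by gcongr
          _ = _ := by field_simp; norm_num

/-- Dividing the overlap bound by the square of `N ^ 2 * p ^ 3` gives `1 / (N ^ 2 * p ^ 3) + 3 / (N
* p)`, which is small as soon as `N ^ 2 * p ^ 3` and `N * p` are large. -/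
theorem integral_paths₃_defect_le (h : IsEdgeLaw P p a b) (hV : 8 ≤ Fintype.card V)
    {z : V} (hz : z ∈ rest a b) :
    ∫ G, adjInd G a z * |1 - paths₃ G a b z /
      ((Fintype.card V - 3) * (Fintype.card V - 4) * p ^ 3)| ∂P ≤
      p * (4 * √(1 / ((Fintype.card V) ^ 2 * p ^ 3) + 3 / (Fintype.card V * p))) := by
  have hp := h.pos
  have hN : (8 : ℝ) ≤ Fintype.card V := by exact_mod_cast hV
  have hcard := h.card_erase hz
  have hover := h.sum_paths₃_overlap_le hz
  have hz' := mem_rest.1 hz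
  have hab := h.ne
  have k := h.integral_edgeMonomial_mul_abs_le (((rest a b).erase z).offDiag)
    (fun q ↦ {s(z, q.1), s(q.1, q.2), s(b, q.2)}) 3
    (fun q hq ↦ by
      obtain ⟨hc, hw, hcw⟩ := Finset.mem_offDiag.1 hq
      rw [Finset.mem_erase, mem_rest] at hc hw
      exact card_paths₃ hw.1.symm hc.2.2.symm hcw)
    (fun q hq ↦ by
      obtain ⟨hc, hw, hcw⟩ := Finset.mem_offDiag.1 hq
      exact isFree_paths₃ hz hc hw hcw) (isFree_adj hz)
    (fun q hq ↦ by
      obtain ⟨hc, hw, hcw⟩ := Finset.mem_offDiag.1 hq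
      simp only [Finset.disjoint_singleton_left, Finset.mem_insert, Finset.mem_singleton,
        Sym2.eq_iff, Finset.mem_erase, mem_rest] at hc hw ⊢
      grind)
    (by positivity) hover
  have hoff : ((((rest a b).erase z).offDiag).card : ℝ) =
      (Fintype.card V - 3) * (Fintype.card V - 4) := by
    rw [Finset.offDiag_card, Nat.cast_sub (Nat.le_mul_self _)]
    push_cast
    rw [hcard]
    ring
  rw [hoff] at k
  simp only [edgeMonomial_singleton, Finset.card_singleton, pow_one] at k
  set N : ℝ := ((Fintype.card V : ℕ) : ℝ) with hNd
  set M := (N - 3) * (N - 4) * p ^ 3 with hM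
  -- The inequality `N ^ 2 / 4 ≤ (N - 3) * (N - 4)` holds for `8 ≤ N` and fails at 7.
  have hM4 : N ^ 2 * p ^ 3 / 4 ≤ M := by
    rw [hM]
    have : N ^ 2 / 4 ≤ (N - 3) * (N - 4) := by nlinarith
    have := mul_le_mul_of_nonneg_right this (by positivity : 0 ≤ p ^ 3)
    linarith
  have hM0 : 0 < M := lt_of_lt_of_le (by positivity) hM4
  calc _ = 1 / M * ∫ G, adjInd G a z * |paths₃ G a b z - M| ∂P := by
        rw [← integral_const_mul]
        congr 1
        ext G
        have e : 1 - paths₃ G a b z / M = -(1 / M * (paths₃ G a b z - M)) := by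
          field_simp
          ring
        rw [e, abs_neg, abs_mul, abs_of_pos (by positivity : 0 < 1 / M)]
        ring
    _ ≤ 1 / (N ^ 2 * p ^ 3 / 4) * (p * √(N ^ 2 * (p ^ 3 + 3 * N * p ^ 5))) := by
        refine mul_le_mul (one_div_le_one_div_of_le (by positivity) hM4) k ?_ (by positivity)
        exact integral_nonneg fun G ↦ mul_nonneg (adjInd_nonneg _ _ _) (abs_nonneg _)
    _ = _ := by
        have e : N ^ 2 * (p ^ 3 + 3 * N * p ^ 5) =
            (N ^ 2 * p ^ 3) ^ 2 * (1 / (N ^ 2 * p ^ 3) + 3 / (N * p)) := by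
          field_simp
        rw [e, Real.sqrt_mul (by positivity), Real.sqrt_sq (by positivity)]
        field_simp

end IsEdgeLaw

end Moments

/-! ### Convergence in probability by Markov's inequality -/

section Asymptotics

theorem tendstoInProbability_of_integral_le {ι : Type*} {Ω : ι → Type*} [∀ i, MeasurableSpace (Ω i)]
    [∀ i, Finite (Ω i)] [∀ i, MeasurableSingletonClass (Ω i)] {μ : (i : ι) → ProbabilityMeasure (Ω i)}
    {l : Filter ι} {X Y : (i : ι) → Ω i → ℝ} {c : ℝ} {B : ι → ℝ}
    (hY : ∀ᶠ i in l, ∀ᵐ ω ∂(μ i : Measure (Ω i)), |X i ω - c| ≤ Y i ω)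
    (hB : ∀ᶠ i in l, ∫ ω, Y i ω ∂(μ i : Measure (Ω i)) ≤ B i) (hB0 : Tendsto B l (𝓝 0)) :
    TendstoInProbability X l c μ := by
  intro ε hε
  have hlim : Tendsto (fun i ↦ ENNReal.ofReal (B i / ε)) l (𝓝 0) := by
    simpa using ENNReal.tendsto_ofReal (hB0.div_const ε)
  refine tendsto_of_tendsto_of_tendsto_of_le_of_le' tendsto_const_nhds hlim
    (.of_forall fun _ ↦ zero_le) ?_
  filter_upwards [hY, hB] with i h₁ h₂
  rw [← ofReal_measureReal]
  refine ENNReal.ofReal_le_ofReal ?_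
  rw [le_div_iff₀ hε, mul_comm]
  refine (mul_meas_ge_le_integral_of_nonneg (.of_forall fun ω ↦ abs_nonneg (X i ω - c))
    .of_finite ε).trans ?_
  exact (integral_mono_ae .of_finite .of_finite h₁).trans h₂

theorem tendsto_natCast_Ici :
    Tendsto (fun n : Set.Ici (2 : ℕ) ↦ ((n : ℕ) : ℝ)) atTop atTop :=
  tendsto_comp_val_Ici_atTop.2 tendsto_natCast_atTop_atTop

theorem eventually_Ici_le (k : ℕ) : ∀ᶠ n : Set.Ici (2 : ℕ) in atTop, k ≤ (n : ℕ) :=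
  (tendsto_comp_val_Ici_atTop (f := fun n : ℕ ↦ n)).2 tendsto_id |>.eventually_ge_atTop k

theorem tendsto_const_div_sqrt {ι : Type*} {l : Filter ι} {x : ι → ℝ} (hx : Tendsto x l atTop)
    (c : ℝ) : Tendsto (fun i ↦ c / √(x i)) l (𝓝 0) :=
  (Real.tendsto_sqrt_atTop.comp hx).const_div_atTop c

variable {p : Set.Ici (2 : ℕ) → ℝ} {a b : (n : Set.Ici (2 : ℕ)) → Fin (n : ℕ)}
  {μ : (n : Set.Ici (2 : ℕ)) → ProbabilityMeasure (SimpleGraph (Fin (n : ℕ)))}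

theorem integral_degError_le {V : Type*} [Fintype V] [DecidableEq V] {P : Measure (SimpleGraph V)}
    [IsProbabilityMeasure P] {q : ℝ} {u v : V} (h : IsEdgeLaw P q u v) :
    ∫ G, degError G u v (Fintype.card V * q) ∂P ≤
      2 * (1 / (Fintype.card V * q) + 1 / √(Fintype.card V * q)) := by
  unfold degError
  rw [integral_add .of_finite .of_finite]
  linarith [h.integral_abs_one_sub_rdeg_le, h.symm.integral_abs_one_sub_rdeg_le]

theorem tendstoInProbability_neg_two
    (h : ∀ n : Set.Ici (2 : ℕ), IsEdgeLaw (μ n : Measure (SimpleGraph (Fin (n : ℕ)))) (p n) (a n) (b n))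
    (hx : Tendsto (fun n : Set.Ici (2 : ℕ) ↦ ((n : ℕ) : ℝ) * p n) atTop atTop)
    (h₃ : Tendsto (fun n : Set.Ici (2 : ℕ) ↦ ((n : ℕ) : ℝ) ^ 2 * p n ^ 3) atTop (𝓝 0)) :
    TendstoInProbability (fun n G ↦ ricci G (a n) (b n)) atTop (-2) μ := by
  have hn (n : Set.Ici (2 : ℕ)) : (0 : ℝ) < (n : ℕ) := by
    exact_mod_cast zero_lt_two.trans_le n.2
  have hx0 (n : Set.Ici (2 : ℕ)) : 0 < ((n : ℕ) : ℝ) * p n := mul_pos (hn n) (h n).pos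
  have h₂ : Tendsto (fun n : Set.Ici (2 : ℕ) ↦ ((n : ℕ) : ℝ) * p n ^ 2) atTop (𝓝 0) := by
    refine (h₃.div_atTop hx).congr fun n ↦ ?_
    have := hn n
    have := (h n).pos
    field_simp
  refine tendstoInProbability_of_integral_le
    (.of_forall fun n ↦ (h n).ae_adj.mono fun G hG ↦ abs_ricci_add_two_le hG (hx0 n))
    (B := fun n ↦ 3 * (((n : ℕ) : ℝ) * p n ^ 2) + 6 * (((n : ℕ) : ℝ) * p n ^ 2 +
      ((n : ℕ) : ℝ) ^ 2 * p n ^ 3) + 6 / (((n : ℕ) : ℝ) * p n) +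
      9 * (2 * (1 / (((n : ℕ) : ℝ) * p n) + 1 / √(((n : ℕ) : ℝ) * p n))))
    (.of_forall fun n ↦ ?_) ?_
  · have e₁ := (h n).integral_triCount_le
    have e₂ := (h n).integral_quadCount_le
    have e₃ := (h n).integral_pentCount_le
    have e₄ := integral_degError_le (h n)
    simp only [Fintype.card_fin] at e₁ e₂ e₃ e₄
    rw [integral_add .of_finite .of_finite, integral_add .of_finite .of_finite,
      integral_add .of_finite .of_finite, integral_const_mul, integral_const_mul, integral_div,
      integral_const_mul, integral_add .of_finite .of_finite]
    have e₅ : ∫ _ : SimpleGraph (Fin (n : ℕ)), 6 / (((n : ℕ) : ℝ) * p n)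
        ∂(μ n : Measure (SimpleGraph (Fin (n : ℕ)))) = 6 / (((n : ℕ) : ℝ) * p n) := by simp
    rw [e₅]
    gcongr
    rw [div_le_iff₀ (hx0 n)]
    linarith
  · have t₁ := hx.const_div_atTop 6
    have t₂ := hx.const_div_atTop 1
    have t₃ := tendsto_const_div_sqrt hx 1
    simpa using (((h₂.const_mul 3).add ((h₂.add h₃).const_mul 6)).add t₁).add
      (((t₂.add t₃).const_mul 2).const_mul 9)

theorem tendstoInProbability_neg_one
    (h : ∀ n : Set.Ici (2 : ℕ), IsEdgeLaw (μ n : Measure (SimpleGraph (Fin (n : ℕ)))) (p n) (a n) (b n))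
    (h₃ : Tendsto (fun n : Set.Ici (2 : ℕ) ↦ ((n : ℕ) : ℝ) ^ 2 * p n ^ 3) atTop atTop)
    (h₂ : Tendsto (fun n : Set.Ici (2 : ℕ) ↦ ((n : ℕ) : ℝ) * p n ^ 2) atTop (𝓝 0)) :
    TendstoInProbability (fun n G ↦ ricci G (a n) (b n)) atTop (-1) μ := by
  have hn (n : Set.Ici (2 : ℕ)) : (0 : ℝ) < (n : ℕ) := by
    exact_mod_cast zero_lt_two.trans_le n.2
  have hx0 (n : Set.Ici (2 : ℕ)) : 0 < ((n : ℕ) : ℝ) * p n := mul_pos (hn n) (h n).pos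
  -- Once `n p² ≤ 1`, `n² p³ = (n p) (n p²)` is at most `n p`.
  have hx : Tendsto (fun n : Set.Ici (2 : ℕ) ↦ ((n : ℕ) : ℝ) * p n) atTop atTop := by
    refine tendsto_atTop_mono' _ ?_ h₃
    filter_upwards [h₂.eventually_le_const zero_lt_one] with n h1
    have e : ((n : ℕ) : ℝ) ^ 2 * p n ^ 3 = (((n : ℕ) : ℝ) * p n) * (((n : ℕ) : ℝ) * p n ^ 2) := by
      ring
    rw [e]
    exact mul_le_of_le_one_right (hx0 n).le h1
  have h₁ : Tendsto p atTop (𝓝 0) := by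
    refine (h₂.div_atTop hx).congr fun n ↦ ?_
    have := hn n
    have := (h n).pos
    field_simp
  set D : Set.Ici (2 : ℕ) → ℝ := fun n ↦ 2 / (((n : ℕ) : ℝ) * p n) + 1 / √(((n : ℕ) : ℝ) * p n) +
    4 * √(1 / (((n : ℕ) : ℝ) ^ 2 * p n ^ 3) + 3 / (((n : ℕ) : ℝ) * p n)) with hD
  have hM : ∀ᶠ n : Set.Ici (2 : ℕ) in atTop,
      0 < (((n : ℕ) : ℝ) - 3) * (((n : ℕ) : ℝ) - 4) * p n ^ 3 := by
    filter_upwards [eventually_Ici_le 8] with n h8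
    have : (8 : ℝ) ≤ (n : ℕ) := by exact_mod_cast h8
    have := (h n).pos
    exact mul_pos (mul_pos (by linarith) (by linarith)) (by positivity)
  refine tendstoInProbability_of_integral_le
    (hM.mono fun n hM ↦ (h n).ae_adj.mono fun G hG ↦ abs_ricci_add_one_le hG (hx0 n) hM)
    (B := fun n ↦ 4 * (p n + ((n : ℕ) : ℝ) * p n ^ 2) + 11 * (D n + D n)) ?_ ?_
  · filter_upwards [eventually_Ici_le 8] with n h8
    have e₁ := (h n).integral_triCount_le
    have e₂ := (h n).integral_quadCount_le
    have h8' : 8 ≤ Fintype.card (Fin (n : ℕ)) := by rwa [Fintype.card_fin]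
    have e₃ := (h n).integral_rowDefect_le _ (by positivity)
      (fun z hz ↦ (h n).integral_paths₃_defect_le h8' hz)
    have e₄ := (h n).symm.integral_rowDefect_le _ (by positivity)
      (fun z hz ↦ (h n).symm.integral_paths₃_defect_le h8' hz)
    simp only [Fintype.card_fin] at e₁ e₂ e₃ e₄
    rw [integral_add .of_finite .of_finite, integral_const_mul, integral_div,
      integral_const_mul, integral_add .of_finite .of_finite, integral_add .of_finite .of_finite]
    gcongr
    rw [div_le_iff₀ (hx0 n)]
    linarith
  · have t₁ := hx.const_div_atTop 2
    have t₂ := tendsto_const_div_sqrt hx 1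
    have t₃ : Tendsto (fun n : Set.Ici (2 : ℕ) ↦
        √(1 / (((n : ℕ) : ℝ) ^ 2 * p n ^ 3) + 3 / (((n : ℕ) : ℝ) * p n))) atTop (𝓝 0) := by
      simpa using ((h₃.const_div_atTop 1).add (hx.const_div_atTop 3)).sqrt
    have tD : Tendsto D atTop (𝓝 0) := by
      have := (t₁.add t₂).add (t₃.const_mul 4)
      rwa [mul_zero, add_zero, add_zero] at this
    simpa using ((h₁.add h₂).const_mul 4).add ((tD.add tD).const_mul 11)

/-- The sparse case `q = 0` and the dense case `0 < q` are the same argument; `q < 1` keeps the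
factor `1 - p n` of the normalization away from zero. -/
theorem tendstoInProbability_edge_density
    (h : ∀ n : Set.Ici (2 : ℕ), IsEdgeLaw (μ n : Measure (SimpleGraph (Fin (n : ℕ)))) (p n) (a n) (b n))
    (h₂ : Tendsto (fun n : Set.Ici (2 : ℕ) ↦ ((n : ℕ) : ℝ) * p n ^ 2) atTop atTop)
    {q : ℝ} (hq : q < 1) (hpq : Tendsto p atTop (𝓝 q)) :
    TendstoInProbability (fun n G ↦ ricci G (a n) (b n)) atTop q μ := by
  have hn (n : Set.Ici (2 : ℕ)) : (0 : ℝ) < (n : ℕ) := by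
    exact_mod_cast zero_lt_two.trans_le n.2
  have hx0 (n : Set.Ici (2 : ℕ)) : 0 < ((n : ℕ) : ℝ) * p n := mul_pos (hn n) (h n).pos
  have hx : Tendsto (fun n : Set.Ici (2 : ℕ) ↦ ((n : ℕ) : ℝ) * p n) atTop atTop := by
    refine tendsto_atTop_mono (fun n ↦ ?_) h₂
    have := hn n
    gcongr
    rw [sq]
    exact mul_le_of_le_one_right (h n).pos.le (h n).le_one
  have hlt : ∀ᶠ n in atTop, p n < 1 := hpq.eventually_lt_const hq
  set M : Set.Ici (2 : ℕ) → ℝ := fun n ↦ (((n : ℕ) : ℝ) - 3) * (p n ^ 2 * (1 - p n)) with hMd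
  have hM : ∀ᶠ n : Set.Ici (2 : ℕ) in atTop, 0 < M n := by
    filter_upwards [eventually_Ici_le 6, hlt] with n h6 h1
    have : (6 : ℝ) ≤ (n : ℕ) := by exact_mod_cast h6
    have := (h n).pos
    have : 0 < 1 - p n := by linarith
    exact mul_pos (by linarith) (by positivity)
  set D : Set.Ici (2 : ℕ) → ℝ := fun n ↦ 2 / (((n : ℕ) : ℝ) * p n) + 1 / √(((n : ℕ) : ℝ) * p n) +
    4 / (√(((n : ℕ) : ℝ) * p n ^ 2) * (1 - p n)) with hD
  refine tendstoInProbability_of_integral_le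
    (Y := fun n G ↦ 5 * (rowDefect G (a n) (b n) (((n : ℕ) : ℝ) * p n)
        (fun z ↦ (paths₂ G (a n) (b n) z - triPaths₂ G (a n) (b n) z) / M n) +
        rowDefect G (b n) (a n) (((n : ℕ) : ℝ) * p n)
        (fun w ↦ (paths₂ G (b n) (a n) w - triPaths₂ G (b n) (a n) w) / M n)) +
      |triCount G (a n) (b n) / (((n : ℕ) : ℝ) * p n) - p n| + |p n - q|)
    (hM.mono fun n hM ↦ (h n).ae_adj.mono fun G hG ↦ ?_)
    (B := fun n ↦ 5 * (D n + D n) + (2 / ((n : ℕ) : ℝ) + 1 / √((n : ℕ) : ℝ)) + |p n - q|) ?_ ?_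
  · have e := abs_ricci_sub_triCount_le hG (hx0 n) hM
    have e₁ := abs_sub_le (ricci G (a n) (b n)) (p n) q
    have e₂ := abs_sub_le (ricci G (a n) (b n))
      (triCount G (a n) (b n) / (((n : ℕ) : ℝ) * p n)) (p n)
    linarith
  · filter_upwards [eventually_Ici_le 6, hlt] with n h6 h1
    have h6' : 6 ≤ Fintype.card (Fin (n : ℕ)) := by rwa [Fintype.card_fin]
    have h1' : 0 < 1 - p n := by linarith
    have e₁ := (h n).integral_abs_triCount_sub_le
    have e₃ := (h n).integral_rowDefect_le _ (by positivity)
      (fun z hz ↦ (h n).integral_paths₂_defect_le h6' h1 hz)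
    have e₄ := (h n).symm.integral_rowDefect_le _ (by positivity)
      (fun z hz ↦ (h n).symm.integral_paths₂_defect_le h6' h1 hz)
    simp only [Fintype.card_fin] at e₁ e₃ e₄
    rw [integral_add .of_finite .of_finite, integral_add .of_finite .of_finite,
      integral_const_mul, integral_add .of_finite .of_finite]
    have e₅ : ∫ _ : SimpleGraph (Fin (n : ℕ)), |p n - q|
        ∂(μ n : Measure (SimpleGraph (Fin (n : ℕ)))) = |p n - q| := by simp
    rw [e₅]
    gcongr
  · have t₁ := hx.const_div_atTop 2
    have t₂ := tendsto_const_div_sqrt hx 1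
    have t₃ : Tendsto (fun n : Set.Ici (2 : ℕ) ↦ 4 / (√(((n : ℕ) : ℝ) * p n ^ 2) * (1 - p n)))
        atTop (𝓝 0) := by
      refine Tendsto.const_div_atTop ?_ 4
      exact (Real.tendsto_sqrt_atTop.comp h₂).atTop_mul_pos (sub_pos.2 hq) (hpq.const_sub 1)
    have tD : Tendsto D atTop (𝓝 0) := by
      have := (t₁.add t₂).add t₃
      rwa [add_zero, add_zero] at this
    have t₄ := tendsto_natCast_Ici.const_div_atTop 2
    have t₅ := tendsto_const_div_sqrt tendsto_natCast_Ici 1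
    have t₆ : Tendsto (fun n ↦ |p n - q|) atTop (𝓝 0) := by
      simpa using (hpq.sub_const q).abs
    simpa using (((tD.add tD).const_mul 5).add (t₄.add t₅)).add t₆

theorem tendsto_mul_sq_of_tendsto_pos {q : ℝ} (hq : 0 < q) (hpq : Tendsto p atTop (𝓝 q)) :
    Tendsto (fun n : Set.Ici (2 : ℕ) ↦ ((n : ℕ) : ℝ) * p n ^ 2) atTop atTop :=
  tendsto_natCast_Ici.atTop_mul_pos (by positivity) (hpq.pow 2)

section Isolated

variable {V : Type*} [Fintype V] [DecidableEq V] {G : SimpleGraph V} {u v : V}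

/-- Degrees are integers, so total excess below 1 forces both to be 1. Then the triangle-free lower
bound and the coupling bound both give `W₁ = 1`. -/
theorem isIsolatedEdge_of_rdeg_lt (h : G.Adj u v) (hd : (rdeg G u - 1) + (rdeg G v - 1) < 1) :
    IsIsolatedEdge G u v ∧ ricci G u v = 0 := by
  have h₁ := one_le_rdeg h
  have h₂ := one_le_rdeg h.symm
  have key {u v : V} (h : G.Adj u v) (hd : rdeg G u < 2) : rdeg G u = 1 ∧ G.neighborSet u = {v} := by
    have h1 := one_le_rdeg h
    have hn : (G.neighborSet u).ncard = 1 := by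
      unfold rdeg at h1 hd
      norm_cast at h1 hd
      omega
    refine ⟨by rw [rdeg, hn, Nat.cast_one], ?_⟩
    obtain ⟨w, hw⟩ := Set.ncard_eq_one.1 hn
    have : v ∈ G.neighborSet u := h
    rw [hw, Set.mem_singleton_iff] at this
    rw [hw, this]
  obtain ⟨d₁, n₁⟩ := key h (by linarith)
  obtain ⟨d₂, n₂⟩ := key h.symm (by linarith)
  refine ⟨⟨n₁, n₂⟩, ?_⟩
  have htri : triCount G u v = 0 := by
    refine Finset.sum_eq_zero fun z hz ↦ ?_
    have : ¬ G.Adj u z := by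
      intro hz'
      have : z ∈ G.neighborSet u := hz'
      rw [n₁] at this
      exact (mem_rest.1 hz).2 this
    rw [adjInd_of_not_adj this, zero_mul]
  have l := one_sub_triCount_le h
  have r := transportDist_walkMeasure_le h
  rw [htri, zero_div, sub_zero] at l
  rw [d₁, d₂] at r
  norm_num at r
  rw [ricci_eq h]
  linarith

theorem abs_ricci_le_two (h : G.Adj u v) : |ricci G u v| ≤ 2 := by
  have l := transportDist_nonneg G (walkMeasure G u) (walkMeasure G v)
  have r := transportDist_walkMeasure_le_three h
  rw [ricci_eq h, abs_le]
  constructor <;> linarith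

theorem IsEdgeLaw.integral_rdeg_sub_one_le {P : Measure (SimpleGraph V)} [IsProbabilityMeasure P]
    {q : ℝ} (h : IsEdgeLaw P q u v) : ∫ G, (rdeg G u - 1) ∂P ≤ Fintype.card V * q := by
  have e : ∫ G, (rdeg G u - 1) ∂P = ∫ G, ∑ z ∈ rest u v, adjInd G u z ∂P := by
    refine integral_congr_ae ?_
    filter_upwards [h.ae_adj] with G hG
    rw [rdeg_eq hG]
    ring
  rw [e, integral_finsetSum _ fun _ _ ↦ .of_finite]
  refine (Finset.sum_le_card_nsmul _ _ q fun z hz ↦ ?_).trans ?_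
  · have := h.integral_edgeMonomial (isFree_adj hz)
    rw [Finset.card_singleton, pow_one] at this
    exact this.le
  · rw [nsmul_eq_mul]
    exact mul_le_mul_of_nonneg_right h.card_rest_le h.pos.le

end Isolated

theorem tendstoInProbability_zero_of_subcritical
    (h : ∀ n : Set.Ici (2 : ℕ), IsEdgeLaw (μ n : Measure (SimpleGraph (Fin (n : ℕ)))) (p n) (a n) (b n))
    (hx : Tendsto (fun n : Set.Ici (2 : ℕ) ↦ ((n : ℕ) : ℝ) * p n) atTop (𝓝 0)) :
    TendstoInProbability (fun n G ↦ ricci G (a n) (b n)) atTop 0 μ := by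
  refine tendstoInProbability_of_integral_le
    (Y := fun n G ↦ 2 * ((rdeg G (a n) - 1) + (rdeg G (b n) - 1)))
    (.of_forall fun n ↦ (h n).ae_adj.mono fun G hG ↦ ?_)
    (B := fun n ↦ 2 * (((n : ℕ) : ℝ) * p n + ((n : ℕ) : ℝ) * p n)) (.of_forall fun n ↦ ?_) ?_
  · rw [sub_zero]
    rcases lt_or_ge ((rdeg G (a n) - 1) + (rdeg G (b n) - 1)) 1 with h1 | h1
    · rw [(isIsolatedEdge_of_rdeg_lt hG h1).2, abs_zero]
      linarith [one_le_rdeg hG, one_le_rdeg hG.symm]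
    -- When the edge has a further neighbour, twice the excess degree is at least 2, the trivial
    -- bound on the curvature.
    · exact (abs_ricci_le_two hG).trans (by linarith)
  · have e₁ := (h n).integral_rdeg_sub_one_le
    have e₂ := (h n).symm.integral_rdeg_sub_one_le
    rw [Fintype.card_fin] at e₁ e₂
    rw [integral_const_mul, integral_add .of_finite .of_finite]
    gcongr
  · simpa using (hx.add hx).const_mul 2

theorem tendsto_measure_isIsolatedEdge
    (h : ∀ n : Set.Ici (2 : ℕ), IsEdgeLaw (μ n : Measure (SimpleGraph (Fin (n : ℕ)))) (p n) (a n) (b n))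
    (hx : Tendsto (fun n : Set.Ici (2 : ℕ) ↦ ((n : ℕ) : ℝ) * p n) atTop (𝓝 0)) :
    Tendsto (fun n : Set.Ici (2 : ℕ) ↦ (μ n : Measure (SimpleGraph (Fin (n : ℕ))))
      {G | IsIsolatedEdge G (a n) (b n) ∧ ricci G (a n) (b n) = 0}) atTop (𝓝 1) := by
  have hY : TendstoInProbability
      (fun n G ↦ (rdeg G (a n) - 1) + (rdeg G (b n) - 1)) atTop 0 μ := by
    refine tendstoInProbability_of_integral_le
      (Y := fun n G ↦ (rdeg G (a n) - 1) + (rdeg G (b n) - 1))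
      (.of_forall fun n ↦ (h n).ae_adj.mono fun G hG ↦ ?_)
      (B := fun n ↦ ((n : ℕ) : ℝ) * p n + ((n : ℕ) : ℝ) * p n) (.of_forall fun n ↦ ?_) ?_
    · rw [sub_zero, abs_of_nonneg]
      linarith [one_le_rdeg hG, one_le_rdeg hG.symm]
    · have e₁ := (h n).integral_rdeg_sub_one_le
      have e₂ := (h n).symm.integral_rdeg_sub_one_le
      rw [Fintype.card_fin] at e₁ e₂
      rw [integral_add .of_finite .of_finite]
      gcongr
    · simpa using hx.add hx
  have hlim := ENNReal.Tendsto.sub (tendsto_const_nhds (x := (1 : ℝ≥0∞))) (hY 1 one_pos)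
    (.inl ENNReal.one_ne_top)
  rw [tsub_zero] at hlim
  refine tendsto_of_tendsto_of_tendsto_of_le_of_le hlim tendsto_const_nhds (fun n ↦ ?_)
    fun n ↦ prob_le_one
  dsimp only
  rw [← prob_compl_eq_one_sub (Set.toFinite _).measurableSet]
  refine measure_mono_ae ?_
  filter_upwards [(h n).ae_adj] with G hG hG'
  refine isIsolatedEdge_of_rdeg_lt hG (lt_of_not_ge fun h1 ↦ hG' ?_)
  change 1 ≤ |_ - (0 : ℝ)|
  rw [sub_zero]
  exact h1.trans (le_abs_self _)

end Asymptotics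

/-! ### The Poisson regime: joint degree law and convergence in distribution -/

section PoissonLimit

section DegreeLaw

variable {V : Type*} [Fintype V] [DecidableEq V] {P : Measure (SimpleGraph V)}
  {p : ℝ} {a b : V}

open Classical in
/-- The neighbours of `a` other than `b`. -/
noncomputable def otherNeighbors (G : SimpleGraph V) (a b : V) : Finset V :=
  {z ∈ rest a b | G.Adj a z}

theorem rdeg_eq_card {G : SimpleGraph V} (h : G.Adj a b) :
    rdeg G a = 1 + ((otherNeighbors G a b).card : ℝ) := by
  classical
  rw [rdeg_eq h, otherNeighbors]
  simp [adjInd_apply]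

theorem otherNeighbors_subset (G : SimpleGraph V) (a b : V) : otherNeighbors G a b ⊆ rest a b := by
  classical
  exact Finset.filter_subset _ _

theorem otherNeighbors_eq_iff {G : SimpleGraph V} {A : Finset V} (hA : A ⊆ rest a b) :
    otherNeighbors G a b = A ↔ (∀ z ∈ A, G.Adj a z) ∧ ∀ z ∈ rest a b \ A, ¬ G.Adj a z := by
  constructor
  · rintro rfl
    exact ⟨by simp [otherNeighbors], by simp +contextual [otherNeighbors]⟩
  · rintro ⟨h₁, h₂⟩
    ext z
    simp only [otherNeighbors, Finset.mem_filter]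
    refine ⟨fun ⟨h, h'⟩ ↦ ?_, fun h ↦ ⟨hA h, h₁ z h⟩⟩
    by_contra hz
    exact h₂ z (Finset.mem_sdiff.2 ⟨h, hz⟩) h'

namespace IsEdgeLaw

variable [IsProbabilityMeasure P]

/-- `IsEdgeLaw` speaks only of edges being present. Absent edges are added one at a time by
subtracting the event in which the new edge is present. -/
theorem measureReal_subset_disjoint (h : IsEdgeLaw P p a b) {S T : Finset (Sym2 V)}
    (hS : IsFree a b S) (hT : IsFree a b T) (hST : Disjoint S T) :
    P.real {G | (∀ e ∈ S, e ∈ G.edgeSet) ∧ ∀ e ∈ T, e ∉ G.edgeSet} =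
      p ^ S.card * (1 - p) ^ T.card := by
  induction T using Finset.induction_on generalizing S with
  | empty => simpa [Set.subset_def] using h.measureReal_subset S hS
  | insert e T he ih =>
    have hT' : IsFree a b T := fun e' he' ↦ hT e' (Finset.mem_insert_of_mem he')
    rw [Finset.disjoint_insert_right] at hST
    have h₁ := ih hS hT' hST.2
    have hS' : IsFree a b (insert e S) := by
      intro e' he'
      rcases Finset.mem_insert.1 he' with rfl | he'
      exacts [hT _ (Finset.mem_insert_self _ _), hS _ he']
    have h₂ := ih hS' hT' (Finset.disjoint_insert_left.2 ⟨he, hST.2⟩)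
    have hdiff : {G : SimpleGraph V | (∀ e' ∈ S, e' ∈ G.edgeSet) ∧
        ∀ e' ∈ insert e T, e' ∉ G.edgeSet} =
        {G : SimpleGraph V | (∀ e' ∈ S, e' ∈ G.edgeSet) ∧ ∀ e' ∈ T, e' ∉ G.edgeSet} \
        {G : SimpleGraph V | (∀ e' ∈ insert e S, e' ∈ G.edgeSet) ∧ ∀ e' ∈ T, e' ∉ G.edgeSet} := by
      ext G
      simp only [Finset.forall_mem_insert, Set.mem_sdiff, Set.mem_ofPred_eq]
      tauto
    have hsub : {G : SimpleGraph V | (∀ e' ∈ insert e S, e' ∈ G.edgeSet) ∧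
        ∀ e' ∈ T, e' ∉ G.edgeSet} ⊆ {G : SimpleGraph V | (∀ e' ∈ S, e' ∈ G.edgeSet) ∧
        ∀ e' ∈ T, e' ∉ G.edgeSet} :=
      fun G hG ↦ ⟨fun e' he' ↦ hG.1 e' (Finset.mem_insert_of_mem he'), hG.2⟩
    rw [hdiff, measureReal_sdiff hsub (Set.toFinite _).measurableSet, h₁, h₂, Finset.card_insert_of_notMem hST.1,
      Finset.card_insert_of_notMem he]
    ring

/-- The two endpoints have independent binomial numbers of further neighbours. -/
theorem measureReal_card_otherNeighbors (h : IsEdgeLaw P p a b) (k l : ℕ) :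
    P.real {G | (otherNeighbors G a b).card = k ∧ (otherNeighbors G b a).card = l} =
      (((rest a b).card.choose k) * p ^ k * (1 - p) ^ ((rest a b).card - k)) *
      (((rest a b).card.choose l) * p ^ l * (1 - p) ^ ((rest a b).card - l)) := by
  set R := rest a b with hR
  set m := R.card
  -- Split according to the actual neighbour sets. All pairs in `V` joining `a` or `b` to a third
  -- vertex are distinct, so each piece has a product probability depending only on `k` and `l`.
  have hset : {G | (otherNeighbors G a b).card = k ∧ (otherNeighbors G b a).card = l} =
      ⋃ q ∈ R.powersetCard k ×ˢ R.powersetCard l,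
        {G : SimpleGraph V | otherNeighbors G a b = q.1 ∧ otherNeighbors G b a = q.2} := by
    ext G
    simp only [Set.mem_ofPred_eq, Set.mem_iUnion, Finset.mem_product, Finset.mem_powersetCard,
      exists_prop, Prod.exists]
    constructor
    · rintro ⟨h₁, h₂⟩
      refine ⟨_, _, ⟨⟨otherNeighbors_subset _ _ _, h₁⟩, ?_, h₂⟩, rfl, rfl⟩
      rw [hR, rest_symm]
      exact otherNeighbors_subset _ _ _
    · rintro ⟨A, B, ⟨⟨-, h₁⟩, -, h₂⟩, rfl, rfl⟩
      exact ⟨h₁, h₂⟩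
  rw [hset, measureReal_biUnion_finset]
  · have key : ∀ q ∈ R.powersetCard k ×ˢ R.powersetCard l,
        P.real {G : SimpleGraph V | otherNeighbors G a b = q.1 ∧ otherNeighbors G b a = q.2} =
        (p ^ k * (1 - p) ^ (m - k)) * (p ^ l * (1 - p) ^ (m - l)) := by
      rintro ⟨A, B⟩ hq
      simp only [Finset.mem_product, Finset.mem_powersetCard] at hq
      obtain ⟨⟨hA, hAk⟩, hB, hBl⟩ := hq
      have hinj (u : V) : Function.Injective fun z ↦ s(u, z) := fun z w hzw ↦
        Sym2.congr_right.1 hzw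
      have hdab : ∀ A B : Finset V, A ⊆ R → B ⊆ R →
          Disjoint (A.image fun z ↦ s(a, z)) (B.image fun z ↦ s(b, z)) := by
        intro A B hA hB
        rw [Finset.disjoint_left]
        simp only [Finset.mem_image, not_exists, not_and, forall_exists_index, and_imp]
        rintro e z hz rfl w hw hzw
        rw [Sym2.eq_iff] at hzw
        have h1 := mem_rest.1 (hA hz)
        have h2 := mem_rest.1 (hB hw)
        have := h.ne
        grind
      have hdaa : ∀ u : V, ∀ A : Finset V,
          Disjoint (A.image fun z ↦ s(u, z)) ((R \ A).image fun z ↦ s(u, z)) := by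
        intro u A
        rw [Finset.disjoint_image (hinj u)]
        exact Finset.disjoint_sdiff
      have hfree : ∀ A ⊆ R, IsFree a b (A.image fun z ↦ s(a, z)) ∧
          IsFree a b (A.image fun z ↦ s(b, z)) := by
        intro A hA
        constructor
        · intro e he
          obtain ⟨z, hz, rfl⟩ := Finset.mem_image.1 he
          exact isFree_adj (hA hz) _ (Finset.mem_singleton_self _)
        · intro e he
          obtain ⟨z, hz, rfl⟩ := Finset.mem_image.1 he
          exact isFree_adj' (hA hz) _ (Finset.mem_singleton_self _)
      have hsd (A : Finset V) : R \ A ⊆ R := Finset.sdiff_subset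
      have main := h.measureReal_subset_disjoint
        ((hfree A hA).1.union (hfree B hB).2) ((hfree _ (hsd A)).1.union (hfree _ (hsd B)).2) (by
          rw [Finset.disjoint_union_left, Finset.disjoint_union_right, Finset.disjoint_union_right]
          exact ⟨⟨hdaa a A, hdab _ _ hA (hsd B)⟩, (hdab _ _ (hsd A) hB).symm, hdaa b B⟩)
      rw [Finset.card_union_of_disjoint (hdab A B hA hB),
        Finset.card_union_of_disjoint (hdab _ _ (hsd A) (hsd B)),
        Finset.card_image_of_injective _ (hinj a), Finset.card_image_of_injective _ (hinj b),
        Finset.card_image_of_injective _ (hinj a), Finset.card_image_of_injective _ (hinj b),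
        Finset.card_sdiff_of_subset hA, Finset.card_sdiff_of_subset hB, hAk, hBl] at main
      have hsets : {G : SimpleGraph V | otherNeighbors G a b = A ∧ otherNeighbors G b a = B} =
          {G | (∀ e ∈ (A.image fun z ↦ s(a, z)) ∪ (B.image fun z ↦ s(b, z)), e ∈ G.edgeSet) ∧
          ∀ e ∈ ((R \ A).image fun z ↦ s(a, z)) ∪ ((R \ B).image fun z ↦ s(b, z)),
            e ∉ G.edgeSet} := by
        ext G
        rw [Set.mem_ofPred_eq, otherNeighbors_eq_iff hA,
          otherNeighbors_eq_iff (by rwa [rest_symm]), rest_symm b a]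
        simp only [Set.mem_ofPred_eq, Finset.forall_mem_union, Finset.forall_mem_image,
          SimpleGraph.mem_edgeSet]
        tauto
      rw [hsets, main]
      ring
    rw [Finset.sum_congr rfl key, Finset.sum_const, Finset.card_product, Finset.card_powersetCard,
      Finset.card_powersetCard, nsmul_eq_mul]
    push_cast
    ring
  · intro q _ q' _ hqq
    refine Set.disjoint_left.2 fun G hG hG' ↦ hqq ?_
    exact Prod.ext (hG.1.symm.trans hG'.1) (hG.2.symm.trans hG'.2)
  · exact fun _ _ ↦ (Set.toFinite _).measurableSet

end IsEdgeLaw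

end DegreeLaw

variable {p : Set.Ici (2 : ℕ) → ℝ} {a b : (n : Set.Ici (2 : ℕ)) → Fin (n : ℕ)}
  {μ : (n : Set.Ici (2 : ℕ)) → ProbabilityMeasure (SimpleGraph (Fin (n : ℕ)))}

theorem tendsto_zero_of_tendsto_mul {r : ℝ}
    (hx : Tendsto (fun n : Set.Ici (2 : ℕ) ↦ ((n : ℕ) : ℝ) * p n) atTop (𝓝 r)) :
    Tendsto p atTop (𝓝 0) := by
  refine (hx.div_atTop tendsto_natCast_Ici).congr fun n ↦ ?_
  have : ((n : ℕ) : ℝ) ≠ 0 := by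
    exact_mod_cast (zero_lt_two.trans_le n.2).ne'
  field_simp

/-- The Poisson limit theorem for `n - 2` trials. -/
theorem tendsto_binomial_sub_two {r : ℝ}
    (hx : Tendsto (fun n : Set.Ici (2 : ℕ) ↦ ((n : ℕ) : ℝ) * p n) atTop (𝓝 r)) (k : ℕ) :
    Tendsto (fun n : Set.Ici (2 : ℕ) ↦
      (((n : ℕ) - 2).choose k : ℝ) * p n ^ k * (1 - p n) ^ ((n : ℕ) - 2 - k)) atTop
      (𝓝 (Real.exp (-r) * r ^ k / k.factorial)) := by
  have hp0 := tendsto_zero_of_tendsto_mul hx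
  have hx' : Tendsto (fun n : Set.Ici (2 : ℕ) ↦ (((n : ℕ) - 2 : ℕ) : ℝ) * p n) atTop (𝓝 r) := by
    have := hx.sub (hp0.const_mul 2)
    rw [mul_zero, sub_zero] at this
    refine this.congr fun n ↦ ?_
    rw [Nat.cast_sub n.2]
    push_cast
    ring
  -- Reindexing by the number `m = n - 2` of trials brings the sequence into the form of the
  -- binomial limit theorem.
  let f : ℕ → Set.Ici (2 : ℕ) := fun m ↦ ⟨m + 2, Nat.le_add_left 2 m⟩
  have hf : Tendsto f atTop atTop :=
    tendsto_atTop_mono (f := f) (fun _ ↦ le_rfl) (tendsto_atTop_atTop.2 fun c ↦ ⟨c, fun m hm ↦ by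
      rw [← Subtype.coe_le_coe]
      exact hm.trans (Nat.le_add_right m 2)⟩)
  have hf' (n : Set.Ici (2 : ℕ)) : f ((n : ℕ) - 2) = n := Subtype.ext (Nat.sub_add_cancel n.2)
  have hsub : Tendsto (fun n : Set.Ici (2 : ℕ) ↦ (n : ℕ) - 2) atTop atTop :=
    (tendsto_comp_val_Ici_atTop (f := fun n : ℕ ↦ n - 2)).2 (tendsto_sub_atTop_nat 2)
  have main := tendsto_choose_mul_pow_of_tendsto_mul_atTop (p := fun m ↦ p (f m)) k
    ((hx'.comp hf).congr fun m ↦ by simp [f])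
  refine (main.comp hsub).congr fun n ↦ ?_
  simp only [Function.comp_apply, hf']

/-- The curvature of an edge on no short cycle, in terms of the numbers of further neighbours. -/
noncomputable def treeCurvature (q : ℕ × ℕ) : ℝ :=
  -2 * max (1 - 1 / (1 + (q.1 : ℝ)) - 1 / (1 + (q.2 : ℝ))) 0

/-- Together with the next two lemmas this gives the cycle counts a gap between 0 and 1, so a count
below 1 vanishes. -/
theorem sum_eq_zero_or_one_le {ι : Type*} {J : Finset ι} {f : ι → ℝ}
    (hf : ∀ i ∈ J, f i = 0 ∨ 1 ≤ f i) : ∑ i ∈ J, f i = 0 ∨ 1 ≤ ∑ i ∈ J, f i := by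
  by_cases h : ∀ i ∈ J, f i = 0
  · exact .inl (Finset.sum_eq_zero h)
  · push Not at h
    obtain ⟨i, hi, hne⟩ := h
    refine .inr (((hf i hi).resolve_left hne).trans ?_)
    refine Finset.single_le_sum (f := f) (fun j hj ↦ ?_) hi
    rcases hf j hj with h | h <;> linarith

theorem mul_eq_zero_or_one_le {x y : ℝ} (hx : x = 0 ∨ 1 ≤ x) (hy : y = 0 ∨ 1 ≤ y) :
    x * y = 0 ∨ 1 ≤ x * y := by
  rcases hx with rfl | hx
  · simp
  rcases hy with rfl | hy
  · simp
  exact .inr (one_le_mul_of_one_le_of_one_le hx hy)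

theorem edgeMonomial_eq_zero_or_one_le {V : Type*} (S : Finset (Sym2 V)) (G : SimpleGraph V) :
    edgeMonomial S G = 0 ∨ 1 ≤ edgeMonomial S G := by
  classical
  rw [edgeMonomial_apply]
  split_ifs <;> simp

/-- The expected numbers of triangles, 4-cycles and 5-cycles through the edge are at most `(n p) p`,
`(n p)² p` and `(n p)³ p`, which tend to 0; when all counts vanish the tree formula is exact. -/
theorem tendsto_measure_short_cycle
    (h : ∀ n : Set.Ici (2 : ℕ), IsEdgeLaw (μ n : Measure (SimpleGraph (Fin (n : ℕ))))
      (p n) (a n) (b n)) {r : ℝ}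
    (hx : Tendsto (fun n : Set.Ici (2 : ℕ) ↦ ((n : ℕ) : ℝ) * p n) atTop (𝓝 r)) :
    Tendsto (fun n : Set.Ici (2 : ℕ) ↦ (μ n : Measure (SimpleGraph (Fin (n : ℕ))))
      {G | ricci G (a n) (b n) ≠ treeCurvature
        ((otherNeighbors G (a n) (b n)).card, (otherNeighbors G (b n) (a n)).card)})
      atTop (𝓝 0) := by
  have hp0 := tendsto_zero_of_tendsto_mul hx
  have hY : TendstoInProbability (fun n G ↦ triCount G (a n) (b n) + quadCount G (a n) (b n) +
      pentCount G (a n) (b n)) atTop 0 μ := by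
    refine tendstoInProbability_of_integral_le
      (Y := fun n G ↦ triCount G (a n) (b n) + quadCount G (a n) (b n) + pentCount G (a n) (b n))
      (.of_forall fun n ↦ .of_forall fun G ↦ ?_)
      (B := fun n ↦ ((n : ℕ) : ℝ) * p n ^ 2 + ((n : ℕ) : ℝ) ^ 2 * p n ^ 3 +
        ((n : ℕ) : ℝ) ^ 3 * p n ^ 4) (.of_forall fun n ↦ ?_) ?_
    · rw [sub_zero, abs_of_nonneg]
      exact add_nonneg (add_nonneg (triCount_nonneg _ _ _) (quadCount_nonneg _ _ _))
        (pentCount_nonneg _ _ _)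
    · have e₁ := (h n).integral_triCount_le
      have e₂ := (h n).integral_quadCount_le
      have e₃ := (h n).integral_pentCount_le
      simp only [Fintype.card_fin] at e₁ e₂ e₃
      rw [integral_add .of_finite .of_finite, integral_add .of_finite .of_finite]
      gcongr
    · have := (((hx.mul hp0).add ((hx.pow 2).mul hp0)).add ((hx.pow 3).mul hp0))
      simp only [mul_zero, add_zero] at this
      refine this.congr fun n ↦ ?_
      ring
  refine tendsto_of_tendsto_of_tendsto_of_le_of_le tendsto_const_nhds (hY 1 one_pos)
    (fun _ ↦ zero_le) fun n ↦ ?_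
  refine measure_mono_ae ?_
  filter_upwards [(h n).ae_adj] with G hG hG'
  by_contra hlt
  refine hG' ?_
  replace hlt : ¬ 1 ≤ |triCount G (a n) (b n) + quadCount G (a n) (b n) +
    pentCount G (a n) (b n) - 0| := hlt
  have n₁ := triCount_nonneg G (a n) (b n)
  have n₂ := quadCount_nonneg G (a n) (b n)
  have n₃ := pentCount_nonneg G (a n) (b n)
  rw [sub_zero, abs_of_nonneg (by positivity), not_le] at hlt
  have m := edgeMonomial_eq_zero_or_one_le (V := Fin (n : ℕ)) (G := G)
  have z₁ : triCount G (a n) (b n) = 0 := (sum_eq_zero_or_one_le fun z _ ↦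
    mul_eq_zero_or_one_le (m _) (m _)).resolve_right (by
      change ¬ 1 ≤ triCount G (a n) (b n)
      linarith)
  have z₂ : quadCount G (a n) (b n) = 0 := (sum_eq_zero_or_one_le fun z _ ↦
    mul_eq_zero_or_one_le (m _) (sum_eq_zero_or_one_le fun w _ ↦ m _)).resolve_right (by
      change ¬ 1 ≤ quadCount G (a n) (b n)
      linarith)
  have z₃ : pentCount G (a n) (b n) = 0 := (sum_eq_zero_or_one_le fun z _ ↦
    mul_eq_zero_or_one_le (m _) (sum_eq_zero_or_one_le fun w _ ↦ m _)).resolve_right (by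
      change ¬ 1 ≤ pentCount G (a n) (b n)
      linarith)
  rw [ricci_eq_of_no_short_cycle hG z₁ z₂ z₃, rdeg_eq_card hG, rdeg_eq_card hG.symm, treeCurvature]

/-- By the portmanteau theorem a liminf bound on open sets suffices. The limit law is carried by
countably many values, so its mass on `U` is a supremum over finite sets of degree pairs, where
pointwise convergence of the binomial products is enough and no tightness argument is needed. -/
theorem tendstoInDistribution_ricci
    (h : ∀ n : Set.Ici (2 : ℕ), IsEdgeLaw (μ n : Measure (SimpleGraph (Fin (n : ℕ))))
      (p n) (a n) (b n)) {r : ℝ≥0}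
    (hx : Tendsto (fun n : Set.Ici (2 : ℕ) ↦ ((n : ℕ) : ℝ) * p n) atTop (𝓝 (r : ℝ)))
    {Ω : Type*} [MeasurableSpace Ω] {P : Measure Ω} [IsProbabilityMeasure P] {X₁ X₂ : Ω → ℕ}
    (h₁ : HasLaw X₁ (poissonMeasure r) P) (h₂ : HasLaw X₂ (poissonMeasure r) P)
    (hind : IndepFun X₁ X₂ P) :
    TendstoInDistribution (fun n G ↦ ricci G (a n) (b n)) atTop
      (fun ω ↦ treeCurvature (X₁ ω, X₂ ω))
      (fun n : Set.Ici (2 : ℕ) ↦ (μ n : Measure (SimpleGraph (Fin (n : ℕ))))) P := by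
  have hXm : AEMeasurable (fun ω ↦ (X₁ ω, X₂ ω)) P := h₁.aemeasurable.prodMk h₂.aemeasurable
  have hZm : AEMeasurable (fun ω ↦ treeCurvature (X₁ ω, X₂ ω)) P :=
    (Measurable.of_discrete (f := treeCurvature)).comp_aemeasurable hXm
  refine ⟨fun n ↦ .of_discrete, hZm, ?_⟩
  refine tendsto_of_forall_isOpen_le_liminf' fun U hU ↦ ?_
  simp only [ProbabilityMeasure.coe_mk]
  set w : ℕ → ℝ := fun k ↦ Real.exp (-r) * (r : ℝ) ^ k / k.factorial with hw
  have hw0 k : 0 ≤ w k := by positivity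
  have hlaw (q : ℕ × ℕ) : (P.map fun ω ↦ (X₁ ω, X₂ ω)) {q} = ENNReal.ofReal (w q.1 * w q.2) := by
    rw [(indepFun_iff_map_prod_eq_prod_map_map h₁.aemeasurable h₂.aemeasurable).1 hind,
      h₁.map_eq, h₂.map_eq, ← Prod.mk.eta (p := q), ← Set.singleton_prod_singleton,
      Measure.prod_prod, poissonMeasure_singleton, poissonMeasure_singleton,
      ENNReal.ofReal_mul (hw0 _)]
  have hlim : P.map (fun ω ↦ treeCurvature (X₁ ω, X₂ ω)) U =
      ∑' q : ℕ × ℕ, (treeCurvature ⁻¹' U).indicator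
        (fun q ↦ ENNReal.ofReal (w q.1 * w q.2)) q := by
    have : P.map (fun ω ↦ treeCurvature (X₁ ω, X₂ ω)) =
        (P.map fun ω ↦ (X₁ ω, X₂ ω)).map treeCurvature :=
      (AEMeasurable.map_map_of_aemeasurable
        (Measurable.of_discrete (f := treeCurvature)).aemeasurable hXm).symm
    rw [this, Measure.map_apply .of_discrete hU.measurableSet,
      ← Measure.tsum_indicator_apply_singleton _ _ .of_discrete]
    simp_rw [← hlaw]
  rw [hlim, ENNReal.tsum_eq_iSup_sum]
  refine iSup_le fun F ↦ ?_
  classical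
  rw [Finset.sum_indicator_eq_sum_filter]
  set F' := F.filter (· ∈ treeCurvature ⁻¹' U) with hF'
  let B : Set.Ici (2 : ℕ) → ℕ → ℝ := fun n k ↦
    (((n : ℕ) - 2).choose k : ℝ) * p n ^ k * (1 - p n) ^ ((n : ℕ) - 2 - k)
  let bad : Set.Ici (2 : ℕ) → ℝ≥0∞ := fun n ↦ (μ n : Measure (SimpleGraph (Fin (n : ℕ))))
      {G | ricci G (a n) (b n) ≠ treeCurvature
        ((otherNeighbors G (a n) (b n)).card, (otherNeighbors G (b n) (a n)).card)}
  have hbad : Tendsto bad atTop (𝓝 0) := tendsto_measure_short_cycle h hx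
  have ht : Tendsto (fun n ↦ ∑ q ∈ F', ENNReal.ofReal (B n q.1 * B n q.2) - bad n) atTop
      (𝓝 (∑ q ∈ F', ENNReal.ofReal (w q.1 * w q.2))) := by
    have t₁ : Tendsto (fun n ↦ ∑ q ∈ F', ENNReal.ofReal (B n q.1 * B n q.2)) atTop
        (𝓝 (∑ q ∈ F', ENNReal.ofReal (w q.1 * w q.2))) :=
      tendsto_finsetSum _ fun q _ ↦ ENNReal.tendsto_ofReal
        ((tendsto_binomial_sub_two hx q.1).mul (tendsto_binomial_sub_two hx q.2))
    have := ENNReal.Tendsto.sub t₁ hbad (.inr ENNReal.zero_ne_top)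
    rwa [tsub_zero] at this
  -- It remains to compare for fixed `n`: the event that the degree pair lies in `F'` is contained
  -- in the event that the curvature lies in `U`, up to the bad event.
  rw [← ht.liminf_eq]
  refine liminf_le_liminf (.of_forall fun n ↦ ?_)
  rw [Measure.map_apply .of_discrete hU.measurableSet, tsub_le_iff_right]
  have hcard : (rest (a n) (b n)).card = (n : ℕ) - 2 := by
    rw [card_rest (h n).ne, Fintype.card_fin]
  have hBq (q : ℕ × ℕ) : ENNReal.ofReal (B n q.1 * B n q.2) =
      (μ n : Measure (SimpleGraph (Fin (n : ℕ)))) {G | (otherNeighbors G (a n) (b n)).card = q.1 ∧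
        (otherNeighbors G (b n) (a n)).card = q.2} := by
    rw [← ofReal_measureReal, (h n).measureReal_card_otherNeighbors, hcard]
  simp_rw [hBq]
  rw [← measure_biUnion_finset]
  · refine (measure_mono ?_).trans (measure_union_le _ _)
    intro G hG
    simp only [Set.mem_iUnion, exists_prop] at hG
    obtain ⟨q, hq, h₁, h₂⟩ := hG
    have hqU : treeCurvature q ∈ U := (Finset.mem_filter.1 hq).2
    by_cases hG : ricci G (a n) (b n) = treeCurvature
        ((otherNeighbors G (a n) (b n)).card, (otherNeighbors G (b n) (a n)).card)
    · left
      rw [Set.mem_preimage, hG, h₁, h₂]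
      exact hqU
    · exact .inr hG
  · intro q _ q' _ hqq
    refine Set.disjoint_left.2 fun G hG hG' ↦ hqq ?_
    exact Prod.ext (hG.1.symm.trans hG'.1) (hG.2.symm.trans hG'.2)
  · exact fun _ _ ↦ (Set.toFinite _).measurableSet

end PoissonLimit

end GraphCurvature

/-! ### Assembly of the six regimes -/

theorem mainTheorem5
    -- the number of vertices `n` ranges over the integers `n ≥ 2`
    (p : Set.Ici (2 : ℕ) → I) (hp : ∀ n, 0 < p n)
    (a b : (n : Set.Ici (2 : ℕ)) → Fin (n : ℕ)) (hab : ∀ n, a n ≠ b n)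
    (μ : (n : Set.Ici (2 : ℕ)) → ProbabilityMeasure (SimpleGraph (Fin (n : ℕ))))
    (hμ : ∀ n, μ n = GraphCurvature.erdosRenyiGivenEdge (Fin (n : ℕ)) (p n) (hp n)
      (a n) (b n) (hab n))
    (κ : (n : Set.Ici (2 : ℕ)) → SimpleGraph (Fin (n : ℕ)) → ℝ)
    (hκ : ∀ n G, κ n G = GraphCurvature.ricci G (a n) (b n)) :
    -- (a)
    (Tendsto (fun n : Set.Ici (2 : ℕ) ↦ ((n : ℕ) : ℝ) * (p n : ℝ)) atTop (𝓝 0) →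
      Tendsto (fun n : Set.Ici (2 : ℕ) ↦ (μ n : Measure (SimpleGraph (Fin (n : ℕ))))
        {G | GraphCurvature.IsIsolatedEdge G (a n) (b n) ∧ κ n G = 0}) atTop (𝓝 1) ∧
      GraphCurvature.TendstoInProbability κ atTop 0 μ) ∧
    -- (b)
    (∀ r : ℝ≥0, 0 < r →
      Tendsto (fun n : Set.Ici (2 : ℕ) ↦ ((n : ℕ) : ℝ) * (p n : ℝ)) atTop (𝓝 (r : ℝ)) →
      ∀ (Ω : Type*) [MeasurableSpace Ω] (P : Measure Ω) [IsProbabilityMeasure P]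
        (X₁ X₂ : Ω → ℕ), HasLaw X₁ (poissonMeasure r) P → HasLaw X₂ (poissonMeasure r) P →
        IndepFun X₁ X₂ P →
        TendstoInDistribution κ atTop
          (fun ω ↦ -2 * max (1 - 1 / (1 + (X₁ ω : ℝ)) - 1 / (1 + (X₂ ω : ℝ))) 0)
          (fun n : Set.Ici (2 : ℕ) ↦ (μ n : Measure (SimpleGraph (Fin (n : ℕ))))) P) ∧
    -- (c)
    (Tendsto (fun n : Set.Ici (2 : ℕ) ↦ ((n : ℕ) : ℝ) * (p n : ℝ)) atTop atTop →
      Tendsto (fun n : Set.Ici (2 : ℕ) ↦ ((n : ℕ) : ℝ) ^ 2 * (p n : ℝ) ^ 3) atTop (𝓝 0) →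
      GraphCurvature.TendstoInProbability κ atTop (-2) μ) ∧
    -- (d)
    (Tendsto (fun n : Set.Ici (2 : ℕ) ↦ ((n : ℕ) : ℝ) ^ 2 * (p n : ℝ) ^ 3) atTop atTop →
      Tendsto (fun n : Set.Ici (2 : ℕ) ↦ ((n : ℕ) : ℝ) * (p n : ℝ) ^ 2) atTop (𝓝 0) →
      GraphCurvature.TendstoInProbability κ atTop (-1) μ) ∧
    -- (e)
    (Tendsto (fun n : Set.Ici (2 : ℕ) ↦ ((n : ℕ) : ℝ) * (p n : ℝ) ^ 2) atTop atTop →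
      Tendsto (fun n : Set.Ici (2 : ℕ) ↦ (p n : ℝ)) atTop (𝓝 0) →
      GraphCurvature.TendstoInProbability κ atTop 0 μ) ∧
    -- (f)
    (∀ q : ℝ, 0 < q → q < 1 → Tendsto (fun n : Set.Ici (2 : ℕ) ↦ (p n : ℝ)) atTop (𝓝 q) →
      GraphCurvature.TendstoInProbability κ atTop q μ) := by
  have h (n : Set.Ici (2 : ℕ)) : GraphCurvature.IsEdgeLaw
      (μ n : Measure (SimpleGraph (Fin (n : ℕ)))) (p n) (a n) (b n) := by
    rw [hμ n]
    exact GraphCurvature.isEdgeLaw_erdosRenyiGivenEdge _ _ _ _ _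
  obtain rfl : κ = fun n G ↦ GraphCurvature.ricci G (a n) (b n) := by
    ext n G
    exact hκ n G
  refine ⟨fun hx ↦ ⟨GraphCurvature.tendsto_measure_isIsolatedEdge h hx,
      GraphCurvature.tendstoInProbability_zero_of_subcritical h hx⟩,
    fun r _ hx Ω _ P _ X₁ X₂ h₁ h₂ hind ↦
      GraphCurvature.tendstoInDistribution_ricci h hx h₁ h₂ hind,
    fun hx h₃ ↦ GraphCurvature.tendstoInProbability_neg_two h hx h₃,
    fun h₃ h₂ ↦ GraphCurvature.tendstoInProbability_neg_one h h₃ h₂,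
    fun h₂ hp0 ↦ GraphCurvature.tendstoInProbability_edge_density h h₂ zero_lt_one hp0,
    fun q hq hq1 hpq ↦ GraphCurvature.tendstoInProbability_edge_density h
      (GraphCurvature.tendsto_mul_sq_of_tendsto_pos hq hpq) hq1 hpq⟩
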